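/- **Conventions.** A spectral triple $(\mathcal A,H,D)$ for a (not necessarily unital) $C^*$-algebra $\mathcal A$ consists of a representation ($*$-homomorphism, not necessarily faithful) $\pi:\mathcal A\to\mathcal B(H)$ on a separable Hilbert space and a (generally unbounded) self-adjoint operator $D$ on $H$ such that $$\mathcal A_\infty=\{a\in\mathcal A:\ \pi(a)\,\mathrm{Dom}\,D\subseteq \mathrm{Dom}\,D,\ [D,\pi(a)]\text{ is bounded},\ \pi(a)(1+D^2)^{-1}\text{ is compact}\}$$ is dense in $\mathcal A$; "odd" means that no grading is given. It is even with respect to $\gamma=\gamma^*\in\mathcal B(H)$, $\gamma^2=1$, if $\gamma$ commutes with $\pi(\mathcal A)$, preserves $\mathrm{Dom}\,D$ and satisfies $D\gamma=-\gamma D$. For real $p>0$ it is $(p,\infty)$-summable if the singular numbers satisfy $\mu_n\big((1+D^2)^{-1/2}\big)=O(n^{-1/p})$, where $\mu_n(T)$ is the distance in norm from $T$ to the operators of rank at most $n$. Let $\alpha$ be an automorphism of $\mathcal A$. A representation $\pi$ of $\mathcal A$ on $H$ induces operators on $\ell^2(\mathbb Z,H)$, for $a\in\mathcal A$, $n\in\mathbb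 Z$, $$\big(\tilde\pi(a\otimes V^n)\xi\big)(k)=\pi(\alpha^k(a))\,\xi(k+n).$$ The reduced crossed product $\mathcal A\rtimes_\alpha\mathbb Z$ is the $C^*$-algebra generated by the operators $\tilde\rho(a\otimes V^n)$ on $\ell^2(\mathbb Z,K)$, for a faithful representation $\rho$ of $\mathcal A$ on a Hilbert space $K$ (the statement below holds for every choice of $\rho$). **Theorem 3.4.** Let $(\mathcal A,H,D)$ be an odd spectral triple such that $D$ has compact resolvent. Assume that $\mathcal A_\infty$ contains a dense subalgebra $\mathcal A'_\infty$ of $\mathcal A$ with $\alpha(\mathcal A'_\infty)\subseteq\mathcal A'_\infty$ such that for each $a\in\mathcal A'_\infty$ and each $n\in\mathbb Z$ the operator $\pi(\alpha^n(a))$ preserves $\mathrm{Dom}\,D$ and $\sup_{n\in\mathbb Z}\|[D,\pi(\alpha^n(a))]\|<\infty$. Let $D_0=D\otimes 1+i\otimes\partial$ on $\ell^2(\mathbb Z,H)=H\otimes\ell^2(\mathbb Z)$, with domain $\mathrm{Dom}(D\otimes1)\cap\mathrm{Dom}(1\otimes\partial)$, where $\partial=-i\,d/d\theta$ is the Dirac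 operator of the circle, $\ell^2(\mathbb Z)$ being identified with $L^2(S^1)$ so that $e^{i\theta}$ acts as the shift $(Vf)(k)=f(k+1)$; that is, $(\partial f)(k)=-k f(k)$ and $(D_0\xi)(k)=D(\xi(k))-ik\,\xi(k)$. Put $$\mathcal H=\ell^2(\mathbb Z,H)\oplus\ell^2(\mathbb Z,H),\qquad \mathcal D=\begin{pmatrix}0&D_0^*\\ D_0&0\end{pmatrix},\qquad \gamma=\begin{pmatrix}1&0\\0&-1\end{pmatrix}.$$ Then there is a representation of $\mathcal A\rtimes_\alpha\mathbb Z$ on $\mathcal H$ which sends each $a\otimes V^n$ to $\tilde\pi(a\otimes V^n)\oplus\tilde\pi(a\otimes V^n)$, and with it $(\mathcal A\rtimes_\alpha\mathbb Z,\mathcal H,\mathcal D)$ is an even spectral triple with respect to $\gamma$; moreover $\mathcal D$ has compact resolvent. If $(\mathcal A,H,D)$ is $(p,\infty)$-summable for some real $p>0$, then $(\mathcal A\rtimes_\alpha\mathbb Z,\mathcal H,\mathcal D)$ is $(p+1,\infty)$-summable. -/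

import Mathlib

open scoped InnerProductSpace LinearPMap

noncomputable section

namespace SpectralTriple

/-! ### Unbounded operators: resolvents, commutators, singular numbers -/

section Operators

variable {H : Type*} [NormedAddCommGroup H] [InnerProductSpace ℂ H]

/-- `R` is the everywhere defined bounded inverse `(D - z)⁻¹`. -/
def IsResolventAt (D : H →ₗ.[ℂ] H) (z : ℂ) (R : H →L[ℂ] H) : Prop :=
  (∀ x : H, ∃ h : R x ∈ D.domain, D ⟨R x, h⟩ - z • R x = x) ∧
    ∀ x : D.domain, R (D x - z • (x : H)) = x

/-- `D` has compact resolvent: `(D - z)⁻¹` exists and is compact for some complex `z`. -/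
def HasCompactResolvent (D : H →ₗ.[ℂ] H) : Prop :=
  ∃ (z : ℂ) (R : H →L[ℂ] H), IsResolventAt D z R ∧ IsCompactOperator R

/-- `R` is the everywhere defined bounded inverse `(1 + D²)⁻¹`,
where `Dom D² = {x ∈ Dom D | D x ∈ Dom D}`. -/
def IsInvOneAddSq (D : H →ₗ.[ℂ] H) (R : H →L[ℂ] H) : Prop :=
  (∀ x : H, ∃ (h : R x ∈ D.domain) (h' : D ⟨R x, h⟩ ∈ D.domain),
      R x + D ⟨D ⟨R x, h⟩, h'⟩ = x) ∧
    ∀ (x : D.domain) (h : D x ∈ D.domain), R ((x : H) + D ⟨D x, h⟩) = x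

/-- `T` maps `Dom D` to itself and the commutator `[D, T]` is bounded on `Dom D`,
with norm at most `C`. -/
def CommutatorBoundedBy (D : H →ₗ.[ℂ] H) (T : H →L[ℂ] H) (C : ℝ) : Prop :=
  ∀ x : D.domain, ∃ h : T x ∈ D.domain, ‖D ⟨T x, h⟩ - T (D x)‖ ≤ C * ‖(x : H)‖

/-- The singular numbers `μ₀(T) ≥ μ₁(T) ≥ …` of a bounded operator:
`μₙ(T)` is the distance from `T` to the operators of rank at most `n`. -/
def singularNumber (T : H →L[ℂ] H) (n : ℕ) : ℝ :=
  sInf {r : ℝ | ∃ F : H →L[ℂ] H, (F : H →ₗ[ℂ] H).rank ≤ n ∧ r = ‖T - F‖}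

/-- The weak Schatten class `L^{(p,∞)}`: `μₙ(T) = O(n^{-1/p})`. -/
def MemWeakSchatten (p : ℝ) (T : H →L[ℂ] H) : Prop :=
  ∃ C : ℝ, ∀ n : ℕ, singularNumber T n ≤ C * ((n : ℝ) + 1) ^ (-(1 / p))

/-- `(p,∞)`-summability: the positive operator `(1 + D²)^{-1/2}` lies in `L^{(p,∞)}`. -/
def IsWeaklySummable (D : H →ₗ.[ℂ] H) (p : ℝ) : Prop :=
  ∃ T : H →L[ℂ] H, T.IsPositive ∧ IsInvOneAddSq D (T ∘L T) ∧ MemWeakSchatten p T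

end Operators

/-! ### Spectral triples -/

section Triples

variable {A : Type*} [NonUnitalCStarAlgebra A]
  {H : Type*} [NormedAddCommGroup H] [InnerProductSpace ℂ H] [CompleteSpace H]

/-- The set `A_∞` of all `a` such that `a Dom D ⊆ Dom D`, `[D, a]` is bounded and
`a (1 + D²)⁻¹` is compact. -/
def smoothPart (π : A →⋆ₙₐ[ℂ] (H →L[ℂ] H)) (D : H →ₗ.[ℂ] H) : Set A :=
  {a | (∃ C : ℝ, CommutatorBoundedBy D (π a) C) ∧
    ∃ R : H →L[ℂ] H, IsInvOneAddSq D R ∧ IsCompactOperator (π a ∘L R)}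

/-- An (odd, i.e. ungraded) spectral triple `(A, H, D)` for a not necessarily unital C⋆-algebra.
The representation need not be faithful. -/
structure IsSpectralTriple (π : A →⋆ₙₐ[ℂ] (H →L[ℂ] H)) (D : H →ₗ.[ℂ] H) : Prop where
  separable : TopologicalSpace.SeparableSpace H
  /-- For `LinearPMap`, self-adjointness includes density of the domain. -/
  selfAdjoint : IsSelfAdjoint D
  dense_smoothPart : Dense (smoothPart π D)

/-- An even spectral triple: a spectral triple with a grading `γ = γ* = γ⁻¹` that commutes
with the algebra, preserves the domain of `D` and anticommutes with `D`. -/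
structure IsEvenSpectralTriple (π : A →⋆ₙₐ[ℂ] (H →L[ℂ] H)) (D : H →ₗ.[ℂ] H)
    (γ : H →L[ℂ] H) : Prop extends IsSpectralTriple π D where
  grading_selfAdjoint : IsSelfAdjoint γ
  grading_sq : γ * γ = 1
  grading_comm : ∀ a : A, γ * π a = π a * γ
  grading_anticomm : ∀ x : D.domain, ∃ h : γ x ∈ D.domain, D ⟨γ x, h⟩ = -γ (D x)

end Triples

/-! ### The regular representation and the reduced crossed product by `ℤ` -/

/-- The Hilbert space `ℓ²(ℤ, H)`. -/
abbrev L2Z (H : Type*) [NormedAddCommGroup H] := lp (fun _ : ℤ => H) 2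

section Crossed

variable {A : Type*} [NonUnitalCStarAlgebra A]
  {H : Type*} [NormedAddCommGroup H] [InnerProductSpace ℂ H] [CompleteSpace H]

lemma regular_hasSum {H : Type*} [NormedAddCommGroup H] (ξ : L2Z H) (n : ℤ) :
    HasSum (fun k => ‖ξ (k + n)‖ ^ 2) (‖ξ‖ ^ 2) := by
  have h := lp.hasSum_norm (p := 2) (by norm_num) ξ
  simp only [ENNReal.toReal_ofNat, Real.rpow_ofNat] at h
  exact (Equiv.hasSum_iff (Equiv.addRight n)).2 h

lemma regular_norm_le (π : A →⋆ₙₐ[ℂ] (H →L[ℂ] H)) (α : A ≃⋆ₐ[ℂ] A) (a : A) (k : ℤ) (x : H) :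
    ‖π ((α ^ k) a) x‖ ≤ ‖a‖ * ‖x‖ := by
  refine ((π ((α ^ k) a)).le_opNorm x).trans ?_
  gcongr
  exact (NonUnitalStarAlgHom.norm_apply_le π _).trans
    (NonUnitalStarAlgHom.norm_apply_le (α ^ k) a)

lemma regular_memℓp (π : A →⋆ₙₐ[ℂ] (H →L[ℂ] H)) (α : A ≃⋆ₐ[ℂ] A) (a : A) (n : ℤ) (ξ : L2Z H) :
    Memℓp (fun k : ℤ => π ((α ^ k) a) (ξ (k + n))) 2 := by
  refine memℓp_gen ?_
  simp only [ENNReal.toReal_ofNat, Real.rpow_ofNat]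
  refine Summable.of_nonneg_of_le (fun _ => by positivity) (fun k => ?_)
    ((regular_hasSum ξ n).summable.mul_left (‖a‖ ^ 2))
  rw [← mul_pow]
  gcongr
  exact regular_norm_le π α a k _

/-- The operator of `a ⊗ Vⁿ` in the regular representation on `ℓ²(ℤ, H)` induced by `π`:
`((a ⊗ Vⁿ) ξ)(k) = π(αᵏ(a)) ξ(k + n)`. -/
def regularOp (π : A →⋆ₙₐ[ℂ] (H →L[ℂ] H)) (α : A ≃⋆ₐ[ℂ] A) (a : A) (n : ℤ) :
    L2Z H →L[ℂ] L2Z H :=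
  LinearMap.mkContinuous
    { toFun := fun ξ => ⟨fun k => π ((α ^ k) a) (ξ (k + n)), regular_memℓp π α a n ξ⟩
      map_add' := fun ξ η => by ext k; exact map_add (π ((α ^ k) a)) _ _
      map_smul' := fun c ξ => by ext k; exact map_smul (π ((α ^ k) a)) _ _ }
    ‖a‖ (fun ξ => by
      refine lp.norm_le_of_forall_sum_le (by norm_num) (by positivity) (fun s => ?_)
      simp only [ENNReal.toReal_ofNat, Real.rpow_ofNat]
      calc ∑ k ∈ s, ‖π ((α ^ k) a) (ξ (k + n))‖ ^ 2
          ≤ ∑ k ∈ s, ‖a‖ ^ 2 * ‖ξ (k + n)‖ ^ 2 := by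
            refine Finset.sum_le_sum fun k _ => ?_
            rw [← mul_pow]
            gcongr
            exact regular_norm_le π α a k _
        _ = ‖a‖ ^ 2 * ∑ k ∈ s, ‖ξ (k + n)‖ ^ 2 := by rw [Finset.mul_sum]
        _ ≤ ‖a‖ ^ 2 * ‖ξ‖ ^ 2 := by
            gcongr
            exact sum_le_hasSum s (fun _ _ => by positivity) (regular_hasSum ξ n)
        _ = (‖a‖ * ‖ξ‖) ^ 2 := by ring)

lemma regularOp_apply (π : A →⋆ₙₐ[ℂ] (H →L[ℂ] H)) (α : A ≃⋆ₐ[ℂ] A) (a : A) (n : ℤ) (ξ : L2Z H)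
    (k : ℤ) : regularOp π α a n ξ k = π ((α ^ k) a) (ξ (k + n)) := rfl

/-- The C⋆-algebra of operators on `ℓ²(ℤ, H)` generated by all `a ⊗ Vⁿ`. When `π` is faithful,
this is the reduced crossed product `A ⋊_α ℤ`. -/
def reducedCrossedProduct (π : A →⋆ₙₐ[ℂ] (H →L[ℂ] H)) (α : A ≃⋆ₐ[ℂ] A) :
    NonUnitalStarSubalgebra ℂ (L2Z H →L[ℂ] L2Z H) :=
  (NonUnitalStarAlgebra.adjoin ℂ
    (Set.range fun an : A × ℤ => regularOp π α an.1 an.2)).topologicalClosure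

instance (π : A →⋆ₙₐ[ℂ] (H →L[ℂ] H)) (α : A ≃⋆ₐ[ℂ] A) :
    NonUnitalCStarAlgebra (reducedCrossedProduct π α) :=
  NonUnitalStarSubalgebra.nonUnitalCStarAlgebra _
    (h_closed := NonUnitalStarSubalgebra.isClosed_topologicalClosure _)

/-- The element `a ⊗ Vⁿ` of the reduced crossed product. -/
def crossedElem (π : A →⋆ₙₐ[ℂ] (H →L[ℂ] H)) (α : A ≃⋆ₐ[ℂ] A) (a : A) (n : ℤ) :
    reducedCrossedProduct π α :=
  ⟨regularOp π α a n, NonUnitalStarSubalgebra.le_topologicalClosure _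
    (NonUnitalStarAlgebra.subset_adjoin ℂ _ ⟨(a, n), rfl⟩)⟩

end Crossed

/-! ### The Dirac operator on `ℓ²(ℤ, H) ⊕ ℓ²(ℤ, H)` -/

section Dirac

variable {H : Type*} [NormedAddCommGroup H] [InnerProductSpace ℂ H]

/-- The domain of the `ℓ²`-direct sum of a family of unbounded operators on `H`:
`{ξ | ξ(k) ∈ Dom Tₖ for all k, and (Tₖ ξ(k))ₖ ∈ ℓ²}`. -/
def lpDirectSumDomain (T : ℤ → H →ₗ.[ℂ] H) : Submodule ℂ (L2Z H) where
  carrier := {ξ | ∃ h : ∀ k, ξ k ∈ (T k).domain, Memℓp (fun k => T k ⟨ξ k, h k⟩) 2}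
  zero_mem' := by
    refine ⟨fun k => (T k).domain.zero_mem, ?_⟩
    have e : (fun k => T k ⟨(0 : L2Z H) k, (T k).domain.zero_mem⟩) = (0 : ℤ → H) :=
      funext fun k => (T k).map_zero
    rw [e]
    exact zero_memℓp
  add_mem' := by
    rintro ξ η ⟨h, m⟩ ⟨h', m'⟩
    refine ⟨fun k => (T k).domain.add_mem (h k) (h' k), ?_⟩
    have e : (fun k => T k ⟨(ξ + η) k, (T k).domain.add_mem (h k) (h' k)⟩) =
        (fun k => T k ⟨ξ k, h k⟩) + fun k => T k ⟨η k, h' k⟩ :=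
      funext fun k => (T k).map_add ⟨ξ k, h k⟩ ⟨η k, h' k⟩
    rw [e]
    exact m.add m'
  smul_mem' := by
    rintro c ξ ⟨h, m⟩
    refine ⟨fun k => (T k).domain.smul_mem c (h k), ?_⟩
    have e : (fun k => T k ⟨(c • ξ) k, (T k).domain.smul_mem c (h k)⟩) =
        c • fun k => T k ⟨ξ k, h k⟩ :=
      funext fun k => (T k).map_smul c ⟨ξ k, h k⟩
    rw [e]
    exact m.const_smul c

/-- The `ℓ²`-direct sum of a family of unbounded operators on `H`, on its maximal domain:
`(ξ(k))ₖ ↦ (Tₖ ξ(k))ₖ`. -/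
def lpDirectSum (T : ℤ → H →ₗ.[ℂ] H) : L2Z H →ₗ.[ℂ] L2Z H where
  domain := lpDirectSumDomain T
  toFun :=
    { toFun := fun ξ => ⟨fun k => T k ⟨ξ.1 k, ξ.2.choose k⟩, ξ.2.choose_spec⟩
      map_add' := fun ξ η => by
        ext k
        exact (T k).map_add ⟨ξ.1 k, ξ.2.choose k⟩ ⟨η.1 k, η.2.choose k⟩
      map_smul' := fun c ξ => by
        ext k
        exact (T k).map_smul c ⟨ξ.1 k, ξ.2.choose k⟩ }

/-- `D ⊗ 1` on `ℓ²(ℤ, H) = H ⊗ ℓ²(ℤ)`. -/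
def tensorOne (D : H →ₗ.[ℂ] H) : L2Z H →ₗ.[ℂ] L2Z H := lpDirectSum fun _ => D

/-- `1 ⊗ ∂` on `ℓ²(ℤ, H) = H ⊗ ℓ²(ℤ)`, where `∂ = -i d/dθ` is the Dirac operator of the circle.
In the regular representation `(V f)(k) = f(k + 1)`, the function `e^{iθ}` acts as `V`, so the
`k`-th basis vector of `ℓ²(ℤ)` is the Fourier mode `e^{-ikθ}` and `(∂ f)(k) = -k f(k)`. -/
def oneTensorCircleDirac (H : Type*) [NormedAddCommGroup H] [InnerProductSpace ℂ H] :
    L2Z H →ₗ.[ℂ] L2Z H :=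
  lpDirectSum fun k => LinearMap.toPMap ((-(k : ℂ)) • (LinearMap.id : H →ₗ[ℂ] H)) ⊤

/-- `D₀ = D ⊗ 1 + i ⊗ ∂`, with domain `Dom (D ⊗ 1) ∩ Dom (1 ⊗ ∂)`;
thus `(D₀ ξ)(k) = D (ξ(k)) - i k ξ(k)`. -/
def diracZero (D : H →ₗ.[ℂ] H) : L2Z H →ₗ.[ℂ] L2Z H :=
  tensorOne D + Complex.I • oneTensorCircleDirac H

end Dirac

section Doubling

variable {L : Type*} [NormedAddCommGroup L] [InnerProductSpace ℂ L]

/-- The Hilbert space direct sum of two copies of `L`. -/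
abbrev Double (L : Type*) := WithLp 2 (L × L)

/-- The off-diagonal unbounded operator with matrix `(0, S; T, 0)` on `L ⊕ L`:
its domain is `Dom T ⊕ Dom S` and it maps `(x, y)` to `(S y, T x)`. -/
def offDiagonal (S T : L →ₗ.[ℂ] L) : Double L →ₗ.[ℂ] Double L where
  domain :=
    { carrier := {v | v.fst ∈ T.domain ∧ v.snd ∈ S.domain}
      zero_mem' := ⟨T.domain.zero_mem, S.domain.zero_mem⟩
      add_mem' := fun h h' => ⟨T.domain.add_mem h.1 h'.1, S.domain.add_mem h.2 h'.2⟩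
      smul_mem' := fun c _ h => ⟨T.domain.smul_mem c h.1, S.domain.smul_mem c h.2⟩ }
  toFun :=
    { toFun := fun v => WithLp.toLp 2 (S ⟨v.1.snd, v.2.2⟩, T ⟨v.1.fst, v.2.1⟩)
      map_add' := fun v w => by
        rw [← WithLp.toLp_add, Prod.mk_add_mk, ← S.map_add, ← T.map_add]
        rfl
      map_smul' := fun c v => by
        rw [RingHom.id_apply, ← WithLp.toLp_smul, Prod.smul_mk, ← S.map_smul, ← T.map_smul]
        rfl }

/-- The bounded diagonal operator `(x, y) ↦ (S x, T y)` on `L ⊕ L`. -/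
def diagonal (S T : L →L[ℂ] L) : Double L →L[ℂ] Double L :=
  ((WithLp.prodContinuousLinearEquiv 2 ℂ L L).symm : L × L →L[ℂ] Double L) ∘L
    (S.prodMap T) ∘L (WithLp.prodContinuousLinearEquiv 2 ℂ L L : Double L →L[ℂ] L × L)

/-- The grading `γ(x, y) = (x, -y)` on `L ⊕ L`. -/
def grading (L : Type*) [NormedAddCommGroup L] [InnerProductSpace ℂ L] :
    Double L →L[ℂ] Double L :=
  diagonal 1 (-1)

end Doubling

/-- The operator with matrix `(0, D₀*; D₀, 0)` on `ℓ²(ℤ, H) ⊕ ℓ²(ℤ, H)`. -/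
def crossedDirac {H : Type*} [NormedAddCommGroup H] [InnerProductSpace ℂ H] [CompleteSpace H]
    (D : H →ₗ.[ℂ] H) : Double (L2Z H) →ₗ.[ℂ] Double (L2Z H) :=
  offDiagonal (diracZero D)† (diracZero D)

end SpectralTriple

end

/-!
The domain of `D₀` splits over the fibres of `ℓ²(ℤ, H)`: in the fibre over `k` the operator is
`D - i k`, and `‖(D ± i k) x‖² = ‖D x‖² + k² ‖x‖²` for symmetric `D`. Hence `D₀` is the `ℓ²`-direct
sum of the `D - i k` on its maximal domain, its adjoint is the direct sum of the `D + i k`, and `𝒟`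
is self-adjoint (`isSelfAdjoint_crossedDirac`). Unbounded operators are handled through their graphs,
and `FiberGraph` describes those of `D₀` and `D₀*`.

Both `D₀* D₀` and `D₀ D₀*` are `D² + k²` in the fibre over `k`, so `(1 + 𝒟²)^{-1/2}` is the sum of
two copies of `⨁ₖ Tₖ` with `Tₖ = (1 + D² + k²)^{-1/2}`. If `T = (1 + D²)^{-1/2}`, the functional
calculus gives `Tₖ = T Sₖ` with a contraction `Sₖ = (1 + k² T²)^{-1/2}` and `|k| ‖Tₖ‖ ≤ 1`
(`exists_fiber`, `exists_crossed_inverse`). The operators `(1 + D² + k²)⁻¹` and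
`(D ± i k) (1 + D² + k²)⁻¹` are compact with norm at most `1 / |k|`, so their direct sums are compact,
and these give the resolvent of `𝒟` at `i`. For the summability, cut the sum off at `|k| ≤ x` and
replace `T` by an operator of rank at most `x^p` at distance `O(1/x)`: this approximates
`(1 + 𝒟²)^{-1/2}` within `O(1/x)` in rank `O(x^{p+1})` (`memWeakSchatten_diagonal`).

The representation exists although `π` need not be faithful (`exists_regular_representation`): in the
C⋆-algebra generated by the pairs `(ρ̃(a ⊗ Vⁿ), π̃(a ⊗ Vⁿ))`, the matrix entries of every element have
the form `(ρ(a), π(a))`, since the range of the injective homomorphism `a ↦ (ρ(a), π(a))` is closed.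
As `ρ` is faithful, the first component determines the second, and the first projection is an
isometry onto `A ⋊_α ℤ`. Commutators of `𝒟` with `a ⊗ Vⁿ` are `[D, π(αᵏ(a))] ± i n π(αᵏ(a))` in the
fibre over `k`, which is bounded uniformly in `k`; the `a ⊗ Vⁿ` with `a` in the given dense subalgebra
span a dense subspace.
-/

open scoped InnerProductSpace LinearPMap

noncomputable section

namespace SpectralTriple

/-! ### Symmetric operators and the inverse of `1 + D²` -/

section Symmetric

variable {E : Type*} [NormedAddCommGroup E] [InnerProductSpace ℂ E] {D : E →ₗ.[ℂ] E}

lemma mem_graph_iff_exists {x y : E} :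
    (x, y) ∈ D.graph ↔ ∃ h : x ∈ D.domain, D ⟨x, h⟩ = y := by
  rw [LinearPMap.mem_graph_iff]
  constructor
  · rintro ⟨⟨a, ha⟩, rfl, rfl⟩
    exact ⟨ha, rfl⟩
  · rintro ⟨h, rfl⟩
    exact ⟨⟨x, h⟩, rfl, rfl⟩

/-- A self-adjoint operator is characterized by its graph being its own adjoint relation. -/
lemma mem_graph_iff_forall_inner [CompleteSpace E] (hD : IsSelfAdjoint D) {x y : E} :
    (x, y) ∈ D.graph ↔ ∀ a b, (a, b) ∈ D.graph → ⟪b, x⟫_ℂ = ⟪a, y⟫_ℂ := by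
  have h := LinearPMap.adjoint_graph_eq_graph_adjoint hD.dense_domain
  rw [LinearPMap.isSelfAdjoint_def.1 hD] at h
  conv_lhs => rw [h]
  simp only [Submodule.mem_adjoint_iff, sub_eq_zero]

lemma isSelfAdjoint_of_mem_graph_iff [CompleteSpace E] (hd : Dense (D.domain : Set E))
    (h : ∀ x y, (∀ a b, (a, b) ∈ D.graph → ⟪b, x⟫_ℂ = ⟪a, y⟫_ℂ) ↔ (x, y) ∈ D.graph) :
    IsSelfAdjoint D := by
  rw [LinearPMap.isSelfAdjoint_def]
  refine LinearPMap.eq_of_eq_graph ?_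
  rw [LinearPMap.adjoint_graph_eq_graph_adjoint hd]
  ext ⟨x, y⟩
  simp only [Submodule.mem_adjoint_iff, sub_eq_zero]
  exact h x y

lemma isFormalAdjoint_self [CompleteSpace E] (hD : IsSelfAdjoint D) : D.IsFormalAdjoint D := by
  have h := LinearPMap.adjoint_isFormalAdjoint hD.dense_domain
  rwa [LinearPMap.isSelfAdjoint_def.1 hD] at h

/-- For a symmetric operator, `D x` and `i t x` are orthogonal in the real inner product. -/
lemma norm_sq_add_smul (hD : D.IsFormalAdjoint D) {x y : E} (h : (x, y) ∈ D.graph) (t : ℝ) :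
    ‖y + ((t : ℂ) * Complex.I) • x‖ ^ 2 = ‖y‖ ^ 2 + t ^ 2 * ‖x‖ ^ 2 := by
  obtain ⟨hx, rfl⟩ := mem_graph_iff_exists.1 h
  have h1 : ⟪D ⟨x, hx⟩, x⟫_ℂ = ⟪x, D ⟨x, hx⟩⟫_ℂ := hD ⟨x, hx⟩ ⟨x, hx⟩
  have h2 : (⟪D ⟨x, hx⟩, x⟫_ℂ).im = 0 := by
    have h3 := inner_conj_symm (𝕜 := ℂ) x (D ⟨x, hx⟩)
    rw [← h1] at h3
    exact Complex.conj_eq_iff_im.1 h3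
  rw [norm_add_sq (𝕜 := ℂ), inner_smul_right, norm_smul]
  simp [h2, mul_pow]

variable {R : E →L[ℂ] E}

/-- For a symmetric operator, a bounded right inverse of `1 + D²` is a two-sided inverse. -/
lemma isInvOneAddSq_of_graph (hD : D.IsFormalAdjoint D)
    (h : ∀ x, ∃ y, (R x, y) ∈ D.graph ∧ (y, x - R x) ∈ D.graph) : IsInvOneAddSq D R := by
  have key : ∀ x, ∃ (h : R x ∈ D.domain) (h' : D ⟨R x, h⟩ ∈ D.domain),
      R x + D ⟨D ⟨R x, h⟩, h'⟩ = x := by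
    intro x
    obtain ⟨y, h1, h2⟩ := h x
    obtain ⟨hx, rfl⟩ := mem_graph_iff_exists.1 h1
    obtain ⟨hy, h3⟩ := mem_graph_iff_exists.1 h2
    exact ⟨hx, hy, by rw [h3]; abel⟩
  refine ⟨key, fun x hx => ?_⟩
  obtain ⟨h1, h2, h3⟩ := key (x + D ⟨D x, hx⟩)
  set r : D.domain := ⟨R (x + D ⟨D x, hx⟩), h1⟩
  set s : D.domain := ⟨D r, h2⟩
  set u : D.domain := r - x
  set v : D.domain := s - ⟨D x, hx⟩
  have hv : (v : E) = D u := (LinearPMap.map_sub D r x).symm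
  have hw : (u : E) = - D v := by
    have h4 : (r : E) + D s = x + D ⟨D x, hx⟩ := h3
    have h5 : D v = D s - D ⟨D x, hx⟩ := LinearPMap.map_sub D _ _
    have h6 : (u : E) = r - x := rfl
    rw [h5, h6, eq_sub_of_add_eq h4]
    abel
  -- pairing `u + D² u = 0` with `u` gives `‖u‖² + ‖D u‖² = 0`
  have h7 : ⟪D v, (u : E)⟫_ℂ = ⟪(v : E), D u⟫_ℂ := hD v u
  rw [← hv] at h7
  have h8 : ⟪(u : E), (u : E)⟫_ℂ = - ⟪(v : E), (v : E)⟫_ℂ := by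
    rw [← h7, ← inner_neg_left, ← hw]
  have h9 : ‖(u : E)‖ ^ 2 = -‖(v : E)‖ ^ 2 := by
    rw [inner_self_eq_norm_sq_to_K, inner_self_eq_norm_sq_to_K] at h8
    exact_mod_cast h8
  have h10 : ‖(u : E)‖ = 0 := by nlinarith [sq_nonneg ‖(u : E)‖, sq_nonneg ‖(v : E)‖]
  exact sub_eq_zero.1 (norm_eq_zero.1 h10)

lemma IsInvOneAddSq.exists_graph (h : IsInvOneAddSq D R) (x : E) :
    ∃ y, (R x, y) ∈ D.graph ∧ (y, x - R x) ∈ D.graph := by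
  obtain ⟨h1, h2, h3⟩ := h.1 x
  exact ⟨_, mem_graph_iff_exists.2 ⟨h1, rfl⟩, mem_graph_iff_exists.2 ⟨h2, by
    rw [eq_sub_iff_add_eq, add_comm]; exact h3⟩⟩

/-- With `r = (1 + D²)⁻¹ x` and `y = D r`, one has `⟪x, r⟫ = ‖r‖² + ‖y‖²`. This gives both the
positivity of `(1 + D²)⁻¹` and the bounds on `r` and `y`. -/
lemma inner_invOneAddSq (hD : D.IsFormalAdjoint D) {x r y : E} (h : (r, y) ∈ D.graph)
    (h' : (y, x - r) ∈ D.graph) : ⟪x, r⟫_ℂ = ((‖r‖ ^ 2 + ‖y‖ ^ 2 : ℝ) : ℂ) := by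
  obtain ⟨h1, rfl⟩ := mem_graph_iff_exists.1 h
  obtain ⟨h2, h3⟩ := mem_graph_iff_exists.1 h'
  have h4 := hD ⟨_, h2⟩ ⟨_, h1⟩
  rw [h3, inner_sub_left, sub_eq_iff_eq_add] at h4
  change ⟪x, r⟫_ℂ = ⟪D ⟨r, h1⟩, D ⟨r, h1⟩⟫_ℂ + ⟪r, r⟫_ℂ at h4
  rw [h4, inner_self_eq_norm_sq_to_K, inner_self_eq_norm_sq_to_K]
  push_cast
  rw [add_comm]
  rfl

/-- `(1 + D²)⁻¹` is a positive operator. -/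
lemma IsInvOneAddSq.isPositive (h : IsInvOneAddSq D R) (hD : D.IsFormalAdjoint D) :
    R.IsPositive := by
  rw [ContinuousLinearMap.isPositive_iff_complex]
  intro x
  obtain ⟨y, h1, h2⟩ := h.exists_graph x
  have h3 := inner_invOneAddSq hD h1 h2
  have h4 : ⟪R x, x⟫_ℂ = ((‖R x‖ ^ 2 + ‖y‖ ^ 2 : ℝ) : ℂ) := by
    rw [← inner_conj_symm, h3, Complex.conj_ofReal]
  change ((⟪R x, x⟫_ℂ).re : ℂ) = _ ∧ 0 ≤ (⟪R x, x⟫_ℂ).re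
  rw [h4, Complex.ofReal_re]
  exact ⟨rfl, by positivity⟩

/-- `D (1 + D²)⁻¹` is bounded. -/
lemma IsInvOneAddSq.exists_comp (h : IsInvOneAddSq D R) (hD : D.IsFormalAdjoint D) :
    ∃ G : E →L[ℂ] E, ∀ x, (R x, G x) ∈ D.graph ∧ (G x, x - R x) ∈ D.graph := by
  choose g hg hg' using h.exists_graph
  have hg0 : ∀ x, ∃ hx : R x ∈ D.domain, D ⟨R x, hx⟩ = g x :=
    fun x => mem_graph_iff_exists.1 (hg x)
  choose d hd using hg0
  refine ⟨LinearMap.mkContinuous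
    { toFun := g
      map_add' := fun x y => ?_
      map_smul' := fun c x => ?_ } (‖R‖ + 1) fun x => ?_, fun x => ⟨hg x, hg' x⟩⟩
  · rw [← hd x, ← hd y, ← hd, ← D.map_add]
    congr 1
    exact Subtype.ext (map_add R x y)
  · rw [← hd x, ← hd, RingHom.id_apply, ← D.map_smul]
    congr 1
    exact Subtype.ext (map_smul R c x)
  · change ‖g x‖ ≤ _
    have h3 := inner_invOneAddSq hD (hg x) (hg' x)
    have h4 : ‖R x‖ ^ 2 + ‖g x‖ ^ 2 ≤ ‖x‖ * ‖R x‖ := by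
      have h5 := norm_inner_le_norm (𝕜 := ℂ) x (R x)
      rw [h3, Complex.norm_real, Real.norm_of_nonneg (by positivity)] at h5
      exact h5
    have h5 := R.le_opNorm x
    refine abs_le_of_sq_le_sq' ?_ (by positivity) |>.2
    nlinarith [mul_le_mul_of_nonneg_left h5 (norm_nonneg x), sq_nonneg ‖R x‖, norm_nonneg x,
      norm_nonneg R, mul_nonneg (norm_nonneg R) (sq_nonneg ‖x‖), sq_nonneg (‖R‖ * ‖x‖),
      sq_nonneg ‖x‖]

/-- `D (1 + D²)⁻¹ + i (1 + D²)⁻¹` is the resolvent of `D` at `i`. -/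
lemma isResolventAt_I (hD : D.IsFormalAdjoint D) {G : E →L[ℂ] E}
    (hG : ∀ x, (R x, G x) ∈ D.graph ∧ (G x, x - R x) ∈ D.graph) :
    IsResolventAt D Complex.I (G + Complex.I • R) := by
  have key : ∀ x, ((G + Complex.I • R) x, x + Complex.I • (G + Complex.I • R) x) ∈ D.graph := by
    intro x
    have h := D.graph.add_mem (hG x).2 (D.graph.smul_mem Complex.I (hG x).1)
    convert h using 1
    simp only [_root_.add_apply, _root_.smul_apply, Prod.smul_mk,
      Prod.mk_add_mk, smul_add, smul_smul, Complex.I_mul_I, neg_one_smul]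
    congr 1
    abel
  refine ⟨fun x => ?_, fun x => ?_⟩
  · obtain ⟨h, h'⟩ := mem_graph_iff_exists.1 (key x)
    exact ⟨h, by rw [h']; abel⟩
  · have h1 := D.graph.sub_mem (key (D x - Complex.I • (x : E))) (D.mem_graph x)
    rw [Prod.mk_sub_mk] at h1
    have h2 := norm_sq_add_smul hD h1 (-1)
    set w := (G + Complex.I • R) (D x - Complex.I • (x : E))
    have h3 : D x - Complex.I • (x : E) + Complex.I • w - D x +
        (((-1 : ℝ) : ℂ) * Complex.I) • (w - (x : E)) = 0 := by
      push_cast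
      rw [neg_one_mul, neg_smul, smul_sub]
      abel
    rw [h3, norm_zero] at h2
    have h4 : ‖w - (x : E)‖ ^ 2 = 0 := by
      nlinarith [sq_nonneg ‖w - (x : E)‖,
        sq_nonneg ‖D x - Complex.I • (x : E) + Complex.I • w - D x‖]
    exact sub_eq_zero.1 (norm_eq_zero.1 (pow_eq_zero_iff two_ne_zero |>.1 h4))

/-- If `D` has compact resolvent at some point, then `(1 + D²)⁻¹` and `D (1 + D²)⁻¹` are compact. -/
lemma isCompactOperator_of_hasCompactResolvent (h : HasCompactResolvent D) {G : E →L[ℂ] E}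
    (hG : ∀ x, (R x, G x) ∈ D.graph ∧ (G x, x - R x) ∈ D.graph) :
    IsCompactOperator R ∧ IsCompactOperator G := by
  obtain ⟨z, S, hS, hc⟩ := h
  have key : ∀ x y, (x, y) ∈ D.graph → S (y - z • x) = x := by
    intro x y hxy
    obtain ⟨h, rfl⟩ := mem_graph_iff_exists.1 hxy
    exact hS.2 ⟨x, h⟩
  constructor
  · have h1 : R = S ∘L (G - z • R) := by
      ext x
      exact (key _ _ (hG x).1).symm
    rw [h1]
    exact hc.comp_clm _
  · have h1 : G = S ∘L (1 - R - z • G) := by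
      ext x
      exact (key _ _ (hG x).2).symm
    rw [h1]
    exact hc.comp_clm _

lemma commutatorBoundedBy_iff_graph {T : E →L[ℂ] E} {C : ℝ} :
    CommutatorBoundedBy D T C ↔ ∀ x y, (x, y) ∈ D.graph →
      ∃ z, (T x, z) ∈ D.graph ∧ ‖z - T y‖ ≤ C * ‖x‖ := by
  constructor
  · intro h x y hxy
    obtain ⟨hx, rfl⟩ := mem_graph_iff_exists.1 hxy
    obtain ⟨h1, h2⟩ := h ⟨x, hx⟩
    exact ⟨_, mem_graph_iff_exists.2 ⟨h1, rfl⟩, h2⟩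
  · intro h x
    obtain ⟨z, hz, hz'⟩ := h x _ (D.mem_graph x)
    obtain ⟨h1, rfl⟩ := mem_graph_iff_exists.1 hz
    exact ⟨h1, hz'⟩

end Symmetric

/-! ### The fibres `(1 + D² + k²)^{-1/2}` -/

/-- Functional calculus for `S = (1 + k² T²)^{-1/2}` and `Q = S²`. When `T = (1 + D²)^{-1/2}`, one
gets `T S = (1 + D² + k²)^{-1/2}` and `T² Q = (1 + D² + k²)⁻¹`. -/
lemma exists_fiber {B : Type*} [CStarAlgebra B] [PartialOrder B] [StarOrderedRing B] {T : B}
    (hT : 0 ≤ T) (k : ℝ) :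
    ∃ S Q : B, 0 ≤ T * S ∧ ‖S‖ ≤ 1 ∧ |k| * ‖T * S‖ ≤ 1 ∧ T * S * (T * S) = T * T * Q ∧
      Q + ((k ^ 2 : ℝ) : ℂ) • (T * T * Q) = 1 := by
  have hsa : IsSelfAdjoint T := IsSelfAdjoint.of_nonneg hT
  set f : ℝ → ℝ := fun t => (√(1 + k ^ 2 * t ^ 2))⁻¹ with hf
  have hpos : ∀ t : ℝ, 0 < 1 + k ^ 2 * t ^ 2 := fun t => by positivity
  have hfc : Continuous f := by
    refine Continuous.inv₀ (by fun_prop) fun t => ?_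
    exact (Real.sqrt_pos.2 (hpos t)).ne'
  have hff : ∀ t, f t * f t = (1 + k ^ 2 * t ^ 2)⁻¹ := fun t => by
    rw [hf, ← mul_inv, Real.mul_self_sqrt (hpos t).le]
  have hf0 : ∀ t, 0 ≤ f t := fun t => inv_nonneg.2 (Real.sqrt_nonneg _)
  have hid : cfc (fun t : ℝ => t) T = T := cfc_id' ℝ T
  have hTS : T * cfc f T = cfc (fun t => t * f t) T := by
    rw [cfc_mul (fun t : ℝ => t) f T (by fun_prop) hfc.continuousOn, hid]
  have hcomm : cfc f T * T = T * cfc f T := by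
    have h := cfc_commute_cfc f (fun t : ℝ => t) T
    rwa [hid] at h
  refine ⟨cfc f T, cfc f T * cfc f T, ?_, ?_, ?_, ?_, ?_⟩
  · rw [hTS]
    refine cfc_nonneg fun t ht => mul_nonneg ?_ (hf0 t)
    exact spectrum_nonneg_of_nonneg hT ht
  · refine norm_cfc_le zero_le_one fun t _ => ?_
    rw [Real.norm_of_nonneg (hf0 t)]
    refine inv_le_one_of_one_le₀ (Real.one_le_sqrt.2 ?_)
    nlinarith [mul_nonneg (sq_nonneg k) (sq_nonneg t)]
  · rw [hTS]
    have h1 : ‖cfc (fun t => k * (t * f t)) T‖ ≤ 1 := by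
      refine norm_cfc_le zero_le_one fun t _ => ?_
      rw [Real.norm_eq_abs]
      refine abs_le_one_iff_mul_self_le_one.2 ?_
      have h2 : k * (t * f t) * (k * (t * f t)) = k ^ 2 * t ^ 2 * (1 + k ^ 2 * t ^ 2)⁻¹ := by
        rw [← hff]; ring
      rw [h2, ← div_eq_mul_inv, div_le_one (hpos t)]
      linarith
    rw [cfc_const_mul k (fun t => t * f t) T (by fun_prop), norm_smul, Real.norm_eq_abs] at h1
    exact h1
  · rw [mul_assoc, ← mul_assoc (cfc f T), hcomm]
    simp only [mul_assoc]
  · rw [Complex.coe_smul]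
    have h1 : cfc f T * cfc f T = cfc (fun t => f t * f t) T :=
      (cfc_mul f f T hfc.continuousOn hfc.continuousOn).symm
    have h2 : T * T * (cfc f T * cfc f T) = cfc (fun t => t * f t * (t * f t)) T := by
      rw [cfc_mul (fun t => t * f t) (fun t => t * f t) T (by fun_prop) (by fun_prop), ← hTS,
        mul_assoc T (cfc f T), ← mul_assoc (cfc f T) T, hcomm]
      simp only [mul_assoc]
    rw [h2, h1, ← cfc_const_mul (k ^ 2) _ T (by fun_prop),
      ← cfc_add T (fun t => f t * f t) _ (by fun_prop) (by fun_prop)]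
    have h3 : (fun t => f t * f t + k ^ 2 * (t * f t * (t * f t))) = fun _ => 1 := by
      ext t
      have h4 : f t * f t + k ^ 2 * (t * f t * (t * f t)) = f t * f t * (1 + k ^ 2 * t ^ 2) := by
        ring
      rw [h4, hff, inv_mul_cancel₀ (hpos t).ne']
    rw [h3]
    exact cfc_one ℝ T

/-! ### Diagonal operators on `ℓ²(ℤ, H)` -/

section LpDiag

lemma hasSum_norm_sq {H : Type*} [NormedAddCommGroup H] (ξ : L2Z H) :
    HasSum (fun k => ‖ξ k‖ ^ 2) (‖ξ‖ ^ 2) := by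
  simpa using regular_hasSum ξ 0

lemma memℓp_two_iff {H : Type*} [NormedAddCommGroup H] {f : ℤ → H} :
    Memℓp f 2 ↔ Summable fun k => ‖f k‖ ^ 2 := by
  rw [memℓp_gen_iff (by norm_num)]
  simp

variable {H : Type*} [NormedAddCommGroup H] [InnerProductSpace ℂ H]

lemma norm_le_mul_of_forall_norm_le {H : Type*} [NormedAddCommGroup H] {C : ℝ}
    (hC : 0 ≤ C) {ξ η : L2Z H} (σ : ℤ ≃ ℤ)
    (h : ∀ k, ‖ξ k‖ ≤ C * ‖η (σ k)‖) : ‖ξ‖ ≤ C * ‖η‖ := by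
  refine (pow_le_pow_iff_left₀ (norm_nonneg _) (by positivity) two_ne_zero).1 ?_
  rw [mul_pow]
  refine hasSum_le (fun k => ?_) (hasSum_norm_sq ξ)
    (((Equiv.hasSum_iff σ).2 (hasSum_norm_sq η)).mul_left (C ^ 2))
  simp only [Function.comp_apply]
  rw [← mul_pow]
  exact pow_le_pow_left₀ (norm_nonneg _) (h k) 2

/-- The bounded operator `ξ ↦ (B k (ξ k))ₖ` on `ℓ²(ℤ, H)` for a bounded family `B`. -/
def lpDiag (B : ℤ → H →L[ℂ] H) {C : ℝ} (hB : ∀ k, ‖B k‖ ≤ C) : L2Z H →L[ℂ] L2Z H :=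
  lp.mapCLM 2 B ((norm_nonneg _).trans (hB 0)) hB

variable {B : ℤ → H →L[ℂ] H} {C : ℝ}

/-- The finite sum `⨁_{k ∈ s} B k`, extended by `0` to the fibres outside `s`. -/
def lpTrunc (B : ℤ → H →L[ℂ] H) (s : Finset ℤ) : L2Z H →L[ℂ] L2Z H :=
  ∑ k ∈ s, lp.singleContinuousLinearMap ℂ (fun _ : ℤ => H) 2 k ∘L B k ∘L
    lp.evalCLM ℂ (fun _ : ℤ => H) 2 k

lemma lpTrunc_apply (B : ℤ → H →L[ℂ] H) (s : Finset ℤ) (ξ : L2Z H) (k : ℤ) :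
    lpTrunc B s ξ k = if k ∈ s then B k (ξ k) else 0 := by
  have h : lpTrunc B s ξ = ∑ j ∈ s, lp.single 2 j (B j (ξ j)) := by
    rw [lpTrunc, _root_.sum_apply]
    rfl
  rw [h, lp.coeFn_sum, Finset.sum_apply]
  simp only [lp.single_apply, Pi.single_apply]
  rw [Finset.sum_ite_eq]

lemma norm_lpDiag_sub_lpTrunc_le (hB : ∀ k, ‖B k‖ ≤ C) {F : ℤ → H →L[ℂ] H} {s : Finset ℤ} {ε : ℝ}
    (hε : 0 ≤ ε) (h1 : ∀ k ∈ s, ‖B k - F k‖ ≤ ε) (h2 : ∀ k ∉ s, ‖B k‖ ≤ ε) :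
    ‖lpDiag B hB - lpTrunc F s‖ ≤ ε := by
  refine ContinuousLinearMap.opNorm_le_bound _ hε fun ξ => ?_
  refine norm_le_mul_of_forall_norm_le hε (Equiv.refl ℤ) fun k => ?_
  have h : ((lpDiag B hB - lpTrunc F s) ξ) k = B k (ξ k) - lpTrunc F s ξ k := rfl
  rw [h, lpTrunc_apply, Equiv.refl_apply]
  split_ifs with hk
  · exact ((B k - F k).le_opNorm _).trans (by gcongr; exact h1 k hk)
  · rw [sub_zero]
    exact ((B k).le_opNorm _).trans (by gcongr; exact h2 k hk)

/-- A direct sum of compact operators whose norms tend to `0` is compact. -/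
lemma isCompactOperator_lpDiag [CompleteSpace H] (hB : ∀ k, ‖B k‖ ≤ C)
    (hc : ∀ k, IsCompactOperator (B k))
    (h0 : ∀ k : ℤ, |(k : ℝ)| * ‖B k‖ ≤ 1) : IsCompactOperator (lpDiag B hB) := by
  have hmem : lpDiag B hB ∈ closure {T : L2Z H →L[ℂ] L2Z H | IsCompactOperator T} := by
    refine Metric.mem_closure_iff.2 fun ε hε => ?_
    obtain ⟨N, hN⟩ := exists_nat_gt (2 / ε)
    refine ⟨lpTrunc B (Finset.Icc (-(N : ℤ)) N), ?_, ?_⟩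
    · exact (compactOperator (RingHom.id ℂ) (L2Z H) (L2Z H)).sum_mem
        fun k _ => show IsCompactOperator
          (lp.singleContinuousLinearMap ℂ (fun _ : ℤ => H) 2 k ∘ B k ∘
            lp.evalCLM ℂ (fun _ : ℤ => H) 2 k) from ((hc k).comp_clm _).clm_comp _
    · rw [dist_eq_norm]
      refine (norm_lpDiag_sub_lpTrunc_le hB (half_pos hε).le
        (fun k _ => by simpa using (half_pos hε).le) fun k hk => ?_).trans_lt (half_lt_self hε)
      have hk' : (N : ℝ) ≤ |(k : ℝ)| := by
        rw [Finset.mem_Icc, ← abs_le, not_le] at hk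
        exact_mod_cast hk.le
      have h1 := h0 k
      have h2 : 2 < ε * N := by rwa [div_lt_iff₀' hε] at hN
      by_contra! h3
      have h4 : ε * N ≤ 2 := by
        have h5 : N * (ε / 2) ≤ |(k : ℝ)| * ‖B k‖ := by gcongr
        linarith
      linarith
  have hcl := isClosed_setOfPred_isCompactOperator (σ₁₂ := RingHom.id ℂ) (M₁ := L2Z H)
    (M₂ := L2Z H)
  exact hcl.closure_subset hmem

open scoped ComplexOrder in
lemma isPositive_lpDiag (hB : ∀ k, ‖B k‖ ≤ C) (h : ∀ k, (B k).IsPositive) :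
    (lpDiag B hB).IsPositive := by
  refine (ContinuousLinearMap.isPositive_iff _).2 ⟨fun ξ η => ?_, fun ξ => ?_⟩
  · change ⟪lpDiag B hB ξ, η⟫_ℂ = ⟪ξ, lpDiag B hB η⟫_ℂ
    rw [lp.inner_eq_tsum, lp.inner_eq_tsum]
    exact tsum_congr fun k => (h k).inner_left_eq_inner_right _ _
  · rw [lp.inner_eq_tsum]
    exact tsum_nonneg fun k => (h k).inner_nonneg_left _

/-- The rank of `⨁_{k ∈ s} F k` is at most `#s` times a common bound for the ranks. -/
lemma rank_lpTrunc_le {F : ℤ → H →L[ℂ] H} {m : ℕ} (hF : ∀ k, (F k : H →ₗ[ℂ] H).rank ≤ m)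
    (s : Finset ℤ) : (lpTrunc F s : L2Z H →ₗ[ℂ] L2Z H).rank ≤ (s.card * m : ℕ) := by
  induction s using Finset.induction_on with
  | empty => simp [lpTrunc]
  | insert k s hk ih =>
    have e : (lpTrunc F (insert k s) : L2Z H →ₗ[ℂ] L2Z H) =
        ((lp.singleContinuousLinearMap ℂ (fun _ : ℤ => H) 2 k : H →L[ℂ] L2Z H) :
          H →ₗ[ℂ] L2Z H).comp ((F k : H →ₗ[ℂ] H).comp
          (lp.evalCLM ℂ (fun _ : ℤ => H) 2 k : L2Z H →ₗ[ℂ] H)) +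
        (lpTrunc F s : L2Z H →ₗ[ℂ] L2Z H) := by
      rw [lpTrunc, Finset.sum_insert hk]
      rfl
    rw [e]
    refine (LinearMap.rank_add_le _ _).trans ?_
    have h1 := (LinearMap.rank_comp_le_right ((F k : H →ₗ[ℂ] H).comp
      (lp.evalCLM ℂ (fun _ : ℤ => H) 2 k : L2Z H →ₗ[ℂ] H))
      ((lp.singleContinuousLinearMap ℂ (fun _ : ℤ => H) 2 k : H →L[ℂ] L2Z H) : H →ₗ[ℂ] L2Z H))
    have h2 := (LinearMap.rank_comp_le_left
      (lp.evalCLM ℂ (fun _ : ℤ => H) 2 k : L2Z H →ₗ[ℂ] H) (F k : H →ₗ[ℂ] H))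
    have h3 := h1.trans (h2.trans (hF k))
    refine (add_le_add h3 ih).trans ?_
    rw [Finset.card_insert_of_notMem hk]
    push_cast
    rw [add_mul, one_mul, add_comm]

lemma separableSpace_l2Z [TopologicalSpace.SeparableSpace H] :
    TopologicalSpace.SeparableSpace (L2Z H) := by
  rw [← TopologicalSpace.isSeparable_univ_iff]
  set S : Set (L2Z H) := ⋃ k : ℤ, Set.range fun x : H => lp.single 2 k x
  have hS : TopologicalSpace.IsSeparable S := by
    refine TopologicalSpace.IsSeparable.iUnion fun k => TopologicalSpace.isSeparable_range ?_
    exact (lp.singleContinuousLinearMap ℂ (fun _ : ℤ => H) 2 k).continuous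
  refine (hS.span (R := ℂ)).closure.mono fun ξ _ => ?_
  refine mem_closure_of_tendsto (lp.hasSum_single ENNReal.ofNat_ne_top ξ)
    (Filter.Eventually.of_forall fun s => Submodule.sum_mem _ fun k _ => ?_)
  exact Submodule.subset_span (Set.mem_iUnion.2 ⟨k, _, rfl⟩)

end LpDiag

/-! ### The operators `D ⊗ 1 ± i ⊗ ∂` through their graphs -/

section FiberGraph

variable {H : Type*} [NormedAddCommGroup H] [InnerProductSpace ℂ H] {D : H →ₗ.[ℂ] H}

/-- The relation `y = (D ⊗ 1 - s i ⊗ ∂) x`, expressed fibrewise as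
`y(k) = D (x(k)) + s i k x(k)` for all `k`. For `s = -1` this is the graph of `D₀`, and for `s = 1`
it is the graph of `D₀*`. -/
def FiberGraph (D : H →ₗ.[ℂ] H) (s : ℝ) (x y : L2Z H) : Prop :=
  ∀ k : ℤ, (x k, y k - (((s * k : ℝ) : ℂ) * Complex.I) • x k) ∈ D.graph

lemma FiberGraph.single {s : ℝ} {a b : H} (h : (a, b) ∈ D.graph) (k : ℤ) :
    FiberGraph D s (lp.single 2 k a) (lp.single 2 k (b + (((s * k : ℝ) : ℂ) * Complex.I) • a)) := by
  intro j
  obtain rfl | hj := eq_or_ne j k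
  · rw [lp.single_apply_self, lp.single_apply_self, add_sub_cancel_right]
    exact h
  · rw [lp.single_apply_ne _ _ _ hj, lp.single_apply_ne _ _ _ hj, smul_zero, sub_zero]
    exact D.graph.zero_mem

/-- The relations for `s` and `-s` are adjoint to each other. -/
lemma forall_inner_iff_fiberGraph [CompleteSpace H] (hD : IsSelfAdjoint D) {s : ℝ} {y w : L2Z H} :
    (∀ a b, FiberGraph D s a b → ⟪b, y⟫_ℂ = ⟪a, w⟫_ℂ) ↔ FiberGraph D (-s) y w := by
  have key : ∀ (k : ℤ) (a b y w : H), ⟪b, y⟫_ℂ = ⟪a, w - (((-s * k : ℝ) : ℂ) * Complex.I) • y⟫_ℂ ↔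
      ⟪b + (((s * k : ℝ) : ℂ) * Complex.I) • a, y⟫_ℂ = ⟪a, w⟫_ℂ := by
    intro k a b y w
    rw [inner_add_left, inner_smul_left, inner_sub_right, inner_smul_right]
    simp only [map_mul, Complex.conj_I, Complex.conj_ofReal]
    rw [← sub_eq_zero, ← sub_eq_zero (a := _ + _)]
    push_cast
    constructor <;> intro h <;> linear_combination h
  constructor
  · intro h k
    rw [mem_graph_iff_forall_inner hD]
    intro a b hab
    have h1 := h _ _ (FiberGraph.single (s := s) hab k)
    rw [lp.inner_single_left, lp.inner_single_left] at h1
    exact (key k _ _ _ _).2 h1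
  · intro h a b hab
    rw [lp.inner_eq_tsum, lp.inner_eq_tsum]
    refine tsum_congr fun k => ?_
    have h1 := (mem_graph_iff_forall_inner hD).1 (h k) _ _ (hab k)
    rw [key, sub_add_cancel] at h1
    exact h1

/-- Since `‖(D + s i k) x‖² = ‖D x‖² + s² k² ‖x‖²`, the domain of the direct sum of the operators
`D ± i k` is `Dom (D ⊗ 1) ∩ Dom (1 ⊗ ∂)`. -/
lemma FiberGraph.memℓp [CompleteSpace H] (hD : IsSelfAdjoint D) {s : ℝ} (hs : s ^ 2 = 1)
    {x y : L2Z H} (h : FiberGraph D s x y) :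
    Memℓp (fun k => y k - (((s * k : ℝ) : ℂ) * Complex.I) • x k) 2 ∧
      Memℓp (fun k : ℤ => (k : ℂ) • x k) 2 := by
  have h1 : ∀ k : ℤ, ‖y k‖ ^ 2 =
      ‖y k - (((s * k : ℝ) : ℂ) * Complex.I) • x k‖ ^ 2 + ‖(k : ℂ) • x k‖ ^ 2 := by
    intro k
    have h2 := norm_sq_add_smul (isFormalAdjoint_self hD) (h k) (s * k)
    rw [sub_add_cancel, mul_pow, hs, one_mul] at h2
    rw [h2, norm_smul, mul_pow, Complex.norm_intCast, sq_abs]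
  have h2 := (hasSum_norm_sq y).summable
  constructor
  · refine memℓp_two_iff.2 (h2.of_nonneg_of_le (fun _ => by positivity) fun k => ?_)
    rw [h1 k]
    exact le_add_of_nonneg_right (by positivity)
  · refine memℓp_two_iff.2 (h2.of_nonneg_of_le (fun _ => by positivity) fun k => ?_)
    rw [h1 k]
    exact le_add_of_nonneg_left (by positivity)

lemma mem_lpDirectSum_graph {T : ℤ → H →ₗ.[ℂ] H} {x y : L2Z H} :
    (x, y) ∈ (lpDirectSum T).graph ↔ ∀ k, (x k, y k) ∈ (T k).graph := by
  constructor
  · rw [mem_graph_iff_exists]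
    rintro ⟨h, rfl⟩ k
    exact mem_graph_iff_exists.2 ⟨h.choose k, rfl⟩
  · intro h
    have h1 : ∀ k, ∃ hk : x k ∈ (T k).domain, T k ⟨x k, hk⟩ = y k :=
      fun k => mem_graph_iff_exists.1 (h k)
    choose hx hy using h1
    refine mem_graph_iff_exists.2 ⟨⟨hx, ?_⟩, ?_⟩
    · simp_rw [hy]
      exact lp.memℓp y
    · ext k
      exact hy k

lemma mem_diracZero_graph [CompleteSpace H] (hD : IsSelfAdjoint D) {x y : L2Z H} :
    (x, y) ∈ (diracZero D).graph ↔ FiberGraph D (-1) x y := by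
  constructor
  · rw [mem_graph_iff_exists]
    rintro ⟨h, rfl⟩ k
    have h1 := mem_lpDirectSum_graph.1 ((tensorOne D).mem_graph ⟨x, h.1⟩) k
    convert h1 using 2
    have h2 : diracZero D ⟨x, h⟩ =
      tensorOne D ⟨x, h.1⟩ + Complex.I • oneTensorCircleDirac H ⟨x, h.2⟩ := rfl
    have h3 : oneTensorCircleDirac H ⟨x, h.2⟩ k = (-(k : ℂ)) • x k := rfl
    rw [h2, lp.coeFn_add, Pi.add_apply, lp.coeFn_smul, Pi.smul_apply, h3, smul_smul]
    push_cast
    rw [mul_comm Complex.I, neg_one_mul, add_sub_cancel_right]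
  · intro h
    obtain ⟨h1, h2⟩ := h.memℓp hD (by norm_num)
    set z : L2Z H := ⟨_, h1⟩
    set w : L2Z H := -⟨_, h2⟩
    have hz : (x, z) ∈ (tensorOne D).graph := mem_lpDirectSum_graph.2 h
    have hw : (x, w) ∈ (oneTensorCircleDirac H).graph :=
      mem_lpDirectSum_graph.2 fun k => mem_graph_iff_exists.2 ⟨trivial, neg_smul _ _⟩
    obtain ⟨hz1, hz2⟩ := mem_graph_iff_exists.1 hz
    obtain ⟨hw1, hw2⟩ := mem_graph_iff_exists.1 hw
    refine mem_graph_iff_exists.2 ⟨⟨hz1, hw1⟩, ?_⟩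
    have h3 : diracZero D ⟨x, ⟨hz1, hw1⟩⟩ =
      tensorOne D ⟨x, hz1⟩ + Complex.I • oneTensorCircleDirac H ⟨x, hw1⟩ := rfl
    rw [h3, hz2, hw2]
    ext k
    change y k - (((-1 * k : ℝ) : ℂ) * Complex.I) • x k + Complex.I • -((k : ℂ) • x k) = y k
    push_cast
    rw [smul_neg, smul_smul, neg_one_mul, neg_mul, neg_smul, mul_comm Complex.I]
    abel

lemma dense_setOf_fiberGraph [CompleteSpace H] (hD : IsSelfAdjoint D) (s : ℝ) :
    Dense {x : L2Z H | ∃ y, FiberGraph D s x y} := by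
  let S : Submodule ℂ (L2Z H) :=
    { carrier := {x : L2Z H | ∃ y, FiberGraph D s x y}
      zero_mem' := ⟨0, fun k => by simp⟩
      add_mem' := by
        rintro x x' ⟨y, h⟩ ⟨y', h'⟩
        refine ⟨y + y', fun k => ?_⟩
        have := D.graph.add_mem (h k) (h' k)
        convert this using 1
        simp only [lp.coeFn_add, Pi.add_apply, Prod.mk_add_mk, smul_add]
        congr 1
        abel
      smul_mem' := by
        rintro c x ⟨y, h⟩
        refine ⟨c • y, fun k => ?_⟩
        have := D.graph.smul_mem c (h k)
        convert this using 1
        simp only [lp.coeFn_smul, Pi.smul_apply, Prod.smul_mk, smul_sub]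
        rw [smul_comm c] }
  change Dense (S : Set (L2Z H))
  rw [Submodule.dense_iff_topologicalClosure_eq_top, Submodule.eq_top_iff']
  intro ξ
  refine S.isClosed_topologicalClosure.mem_of_tendsto (lp.hasSum_single ENNReal.ofNat_ne_top ξ)
    (Filter.Eventually.of_forall fun t => Submodule.sum_mem _ fun k _ => ?_)
  have h1 : ∀ x : H, lp.single 2 k x ∈ S.topologicalClosure := by
    intro x
    have h2 : IsClosed {x : H | (lp.single 2 k x : L2Z H) ∈ S.topologicalClosure} :=
      S.isClosed_topologicalClosure.preimage
        (lp.singleContinuousLinearMap ℂ (fun _ : ℤ => H) 2 k).continuous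
    refine h2.closure_subset_iff.2 ?_ (hD.dense_domain x)
    intro a ha
    exact S.le_topologicalClosure ⟨_, FiberGraph.single (D.mem_graph ⟨a, ha⟩) k⟩
  exact h1 (ξ k)

lemma mem_diracZero_adjoint_graph [CompleteSpace H] (hD : IsSelfAdjoint D) {x y : L2Z H} :
    (x, y) ∈ (diracZero D)†.graph ↔ FiberGraph D 1 x y := by
  have hd : Dense ((diracZero D).domain : Set (L2Z H)) := by
    refine (dense_setOf_fiberGraph hD (-1)).mono ?_
    rintro x ⟨y, h⟩
    exact (mem_graph_iff_exists.1 ((mem_diracZero_graph hD).2 h)).choose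
  rw [LinearPMap.adjoint_graph_eq_graph_adjoint hd]
  simp only [Submodule.mem_adjoint_iff, sub_eq_zero, mem_diracZero_graph hD]
  rw [forall_inner_iff_fiberGraph hD, neg_neg]

lemma mem_offDiagonal_graph {L : Type*} [NormedAddCommGroup L] [InnerProductSpace ℂ L]
    {S T : L →ₗ.[ℂ] L} {v w : Double L} :
    (v, w) ∈ (offDiagonal S T).graph ↔ (v.snd, w.fst) ∈ S.graph ∧ (v.fst, w.snd) ∈ T.graph := by
  simp only [mem_graph_iff_exists]
  constructor
  · rintro ⟨h, rfl⟩
    exact ⟨⟨h.2, rfl⟩, ⟨h.1, rfl⟩⟩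
  · rintro ⟨⟨h1, h2⟩, ⟨h3, h4⟩⟩
    refine ⟨⟨h3, h1⟩, ?_⟩
    change WithLp.toLp 2 (S ⟨v.snd, h1⟩, T ⟨v.fst, h3⟩) = w
    rw [h2, h4]
    rfl

lemma mem_crossedDirac_graph [CompleteSpace H] (hD : IsSelfAdjoint D) {v w : Double (L2Z H)} :
    (v, w) ∈ (crossedDirac D).graph ↔
      FiberGraph D 1 v.snd w.fst ∧ FiberGraph D (-1) v.fst w.snd := by
  rw [crossedDirac, mem_offDiagonal_graph, mem_diracZero_adjoint_graph hD, mem_diracZero_graph hD]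

theorem isSelfAdjoint_crossedDirac [CompleteSpace H] (hD : IsSelfAdjoint D) :
    IsSelfAdjoint (crossedDirac D) := by
  have hz : ∀ s, FiberGraph D s 0 0 := fun s k => by simp
  refine isSelfAdjoint_of_mem_graph_iff ?_ fun v w => ?_
  · have h1 := (dense_setOf_fiberGraph hD (-1)).prod (dense_setOf_fiberGraph hD 1)
    let e := (WithLp.prodContinuousLinearEquiv 2 ℂ (L2Z H) (L2Z H)).symm
    refine (e.surjective.denseRange.dense_image e.continuous h1).mono ?_
    rintro _ ⟨⟨x, y⟩, ⟨⟨x', hx⟩, ⟨y', hy⟩⟩, rfl⟩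
    exact (mem_graph_iff_exists.1 ((mem_crossedDirac_graph hD (v := WithLp.toLp 2 (x, y))
      (w := WithLp.toLp 2 (y', x'))).2 ⟨hy, hx⟩)).choose
  · rw [mem_crossedDirac_graph hD]
    constructor
    · intro h
      constructor
      · have h1 := (forall_inner_iff_fiberGraph hD (s := -1) (y := v.snd) (w := w.fst)).1 ?_
        · simpa using h1
        intro a b hab
        have h2 := h (WithLp.toLp 2 (a, 0)) (WithLp.toLp 2 (0, b))
          ((mem_crossedDirac_graph hD).2 ⟨hz _, hab⟩)
        simpa [WithLp.prod_inner_apply] using h2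
      · refine (forall_inner_iff_fiberGraph hD (s := 1) (y := v.fst) (w := w.snd)).1 ?_
        intro a b hab
        have h2 := h (WithLp.toLp 2 (0, a)) (WithLp.toLp 2 (b, 0))
          ((mem_crossedDirac_graph hD).2 ⟨hab, hz _⟩)
        simpa [WithLp.prod_inner_apply] using h2
    · rintro ⟨h1, h2⟩ a b hab
      obtain ⟨h3, h4⟩ := (mem_crossedDirac_graph hD).1 hab
      rw [WithLp.prod_inner_apply, WithLp.prod_inner_apply]
      have h5 := (forall_inner_iff_fiberGraph hD (s := 1)).2 h2 _ _ h3
      have h6 := (forall_inner_iff_fiberGraph hD (s := -1)).2 (by simpa using h1) _ _ h4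
      exact (congrArg₂ (· + ·) h5 h6).trans (add_comm _ _)

end FiberGraph

/-! ### Representations of the reduced crossed product -/

section Representation

variable {A : Type*} [NonUnitalCStarAlgebra A]
  {H : Type*} [NormedAddCommGroup H] [InnerProductSpace ℂ H] [CompleteSpace H]
  {K : Type*} [NormedAddCommGroup K] [InnerProductSpace ℂ K] [CompleteSpace K]

lemma regularOp_mul (π : A →⋆ₙₐ[ℂ] (H →L[ℂ] H)) (α : A ≃⋆ₐ[ℂ] A) (a b : A) (n m : ℤ) :
    regularOp π α a n * regularOp π α b m = regularOp π α (a * (α ^ n) b) (n + m) := by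
  ext ξ k
  change π ((α ^ k) a) (π ((α ^ (k + n)) b) (ξ (k + n + m))) =
    π ((α ^ k) (a * (α ^ n) b)) (ξ (k + (n + m)))
  rw [map_mul, map_mul, zpow_add, add_assoc]
  rfl

lemma regularOp_star (π : A →⋆ₙₐ[ℂ] (H →L[ℂ] H)) (α : A ≃⋆ₐ[ℂ] A) (a : A) (n : ℤ) :
    star (regularOp π α a n) = regularOp π α ((α ^ (-n)) (star a)) (-n) := by
  refine ((ContinuousLinearMap.eq_adjoint_iff _ _).2 fun ξ η => ?_).symm
  rw [lp.inner_eq_tsum, lp.inner_eq_tsum, ← (Equiv.addRight n).tsum_eq]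
  refine tsum_congr fun k => ?_
  change ⟪π ((α ^ (k + n)) ((α ^ (-n)) (star a))) (ξ (k + n + -n)), η (k + n)⟫_ℂ =
    ⟪ξ k, π ((α ^ k) a) (η (k + n))⟫_ℂ
  have h : (α ^ (k + n)) ((α ^ (-n)) (star a)) = star ((α ^ k) a) := by
    rw [← map_star, ← StarAlgEquiv.mul_apply, ← zpow_add, add_neg_cancel_right]
  rw [h, map_star, add_neg_cancel_right]
  exact ContinuousLinearMap.adjoint_inner_left _ _ _

lemma norm_regularOp_le (π : A →⋆ₙₐ[ℂ] (H →L[ℂ] H)) (α : A ≃⋆ₐ[ℂ] A) (a : A) (n : ℤ) :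
    ‖regularOp π α a n‖ ≤ ‖a‖ := by
  unfold regularOp
  exact LinearMap.mkContinuous_norm_le _ (norm_nonneg a) _

/-- The map `a ↦ a ⊗ Vⁿ` as a bounded linear map. -/
def regularOpCLM (π : A →⋆ₙₐ[ℂ] (H →L[ℂ] H)) (α : A ≃⋆ₐ[ℂ] A) (n : ℤ) :
    A →L[ℂ] (L2Z H →L[ℂ] L2Z H) :=
  LinearMap.mkContinuous
    { toFun := fun a => regularOp π α a n
      map_add' := fun a b => by
        ext ξ k
        change π ((α ^ k) (a + b)) (ξ (k + n)) =
          π ((α ^ k) a) (ξ (k + n)) + π ((α ^ k) b) (ξ (k + n))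
        rw [map_add, map_add]
        rfl
      map_smul' := fun c a => by
        ext ξ k
        change π ((α ^ k) (c • a)) (ξ (k + n)) = c • π ((α ^ k) a) (ξ (k + n))
        rw [map_smul, map_smul]
        rfl }
    1 (fun a => by
      rw [one_mul]
      exact norm_regularOp_le π α a n)

lemma adjoin_eq_span_of_closed {B : Type*} [NonUnitalRing B] [StarRing B] [Module ℂ B]
    [IsScalarTower ℂ B B] [SMulCommClass ℂ B B] [StarModule ℂ B] {s : Set B}
    (hmul : ∀ x ∈ s, ∀ y ∈ s, x * y ∈ s) (hstar : ∀ x ∈ s, star x ∈ s) :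
    (NonUnitalStarAlgebra.adjoin ℂ s).toSubmodule = Submodule.span ℂ s := by
  rw [NonUnitalStarAlgebra.adjoin_eq_span]
  have h1 : s ∪ star s = s := by
    refine Set.union_eq_left.2 fun x hx => ?_
    simpa using hstar _ hx
  rw [h1]
  congr 1
  exact congrArg SetLike.coe (Subsemigroup.closure_eq ⟨s, fun hx hy => hmul _ hx _ hy⟩)

/-- The matrix entry `(k, l)` of an operator on `ℓ²(ℤ, H)`. -/
def entry (H : Type*) [NormedAddCommGroup H] [InnerProductSpace ℂ H] (k l : ℤ) :
    (L2Z H →L[ℂ] L2Z H) →L[ℂ] (H →L[ℂ] H) :=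
  (ContinuousLinearMap.compL ℂ H (L2Z H) H).flip
      (lp.singleContinuousLinearMap ℂ (fun _ : ℤ => H) 2 l) ∘L
    ContinuousLinearMap.compL ℂ (L2Z H) (L2Z H) H (lp.evalCLM ℂ (fun _ : ℤ => H) 2 k)

lemma entry_apply {H : Type*} [NormedAddCommGroup H] [InnerProductSpace ℂ H]
    (k l : ℤ) (T : L2Z H →L[ℂ] L2Z H) (x : H) :
    entry H k l T x = T (lp.single 2 l x) k := rfl

lemma entry_regularOp (π : A →⋆ₙₐ[ℂ] (H →L[ℂ] H)) (α : A ≃⋆ₐ[ℂ] A) (a : A) (n k l : ℤ) :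
    entry H k l (regularOp π α a n) = π (if k + n = l then (α ^ k) a else 0) := by
  ext x
  rw [entry_apply, regularOp_apply]
  split_ifs with h
  · rw [h, lp.single_apply_self]
  · rw [lp.single_apply_ne _ _ _ h, map_zero, map_zero]
    rfl

lemma eq_zero_of_entry_eq_zero {H : Type*} [NormedAddCommGroup H] [InnerProductSpace ℂ H]
    {T : L2Z H →L[ℂ] L2Z H} (h : ∀ k l, entry H k l T = 0) : T = 0 := by
  refine lp.ext_continuousLinearMap ENNReal.ofNat_ne_top fun l => ?_
  ext x k
  exact congrArg (fun S : H →L[ℂ] H => S x) (h k l)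

variable (α : A ≃⋆ₐ[ℂ] A) (ρ : A →⋆ₙₐ[ℂ] (K →L[ℂ] K)) (π : A →⋆ₙₐ[ℂ] (H →L[ℂ] H))

/-- The elements `a ⊗ Vⁿ`, acting through `ρ` and `π` simultaneously. -/
def jointGenerators : Set ((L2Z K →L[ℂ] L2Z K) × (L2Z H →L[ℂ] L2Z H)) :=
  Set.range fun an : A × ℤ => (regularOp ρ α an.1 an.2, regularOp π α an.1 an.2)

/-- The C⋆-algebra generated by all pairs `(ρ̃(a ⊗ Vⁿ), π̃(a ⊗ Vⁿ))`. For faithful `ρ` it is the graph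
of a homomorphism on `A ⋊_α ℤ`. -/
def jointAlgebra :
    NonUnitalStarSubalgebra ℂ ((L2Z K →L[ℂ] L2Z K) × (L2Z H →L[ℂ] L2Z H)) :=
  (NonUnitalStarAlgebra.adjoin ℂ (jointGenerators α ρ π)).topologicalClosure

instance : NonUnitalCStarAlgebra (jointAlgebra α ρ π) :=
  NonUnitalStarSubalgebra.nonUnitalCStarAlgebra _
    (h_closed := NonUnitalStarSubalgebra.isClosed_topologicalClosure _)

variable {α ρ π}

/-- The entries of an element of the joint algebra come from a single element of `A`: this holds for
the generators, and the range of the injective homomorphism `a ↦ (ρ a, π a)` is closed. -/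
lemma exists_entry_eq (hρ : Function.Injective ρ)
    {p : (L2Z K →L[ℂ] L2Z K) × (L2Z H →L[ℂ] L2Z H)} (hp : p ∈ jointAlgebra α ρ π) (k l : ℤ) :
    ∃ a : A, ρ a = entry K k l p.1 ∧ π a = entry H k l p.2 := by
  let J : A →⋆ₙₐ[ℂ] ((K →L[ℂ] K) × (H →L[ℂ] H)) := ρ.prod π
  have hJ : Function.Injective J := fun a b h => hρ (congrArg Prod.fst h)
  have hcl : IsClosed (Set.range J) :=
    (NonUnitalStarAlgHom.isometry J hJ).isClosedEmbedding.isClosed_range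
  let e : ((L2Z K →L[ℂ] L2Z K) × (L2Z H →L[ℂ] L2Z H)) →L[ℂ] ((K →L[ℂ] K) × (H →L[ℂ] H)) :=
    (entry K k l).prodMap (entry H k l)
  let S : Submodule ℂ ((L2Z K →L[ℂ] L2Z K) × (L2Z H →L[ℂ] L2Z H)) :=
    (NonUnitalStarAlgHom.range J).toSubmodule.comap (e : _ →ₗ[ℂ] _)
  have hS : (S : Set ((L2Z K →L[ℂ] L2Z K) × (L2Z H →L[ℂ] L2Z H))) = e ⁻¹' Set.range J := by
    ext q
    exact NonUnitalStarAlgHom.mem_range J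
  have hle : (NonUnitalStarAlgebra.adjoin ℂ (jointGenerators α ρ π)).toSubmodule ≤ S := by
    rw [adjoin_eq_span_of_closed, Submodule.span_le]
    · rintro _ ⟨⟨a, n⟩, rfl⟩
      rw [hS]
      exact ⟨if k + n = l then (α ^ k) a else 0,
        Prod.ext (entry_regularOp ρ α a n k l).symm (entry_regularOp π α a n k l).symm⟩
    · rintro _ ⟨⟨a, n⟩, rfl⟩ _ ⟨⟨b, m⟩, rfl⟩
      exact ⟨(a * (α ^ n) b, n + m), Prod.ext (regularOp_mul ρ α a b n m).symm
        (regularOp_mul π α a b n m).symm⟩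
    · rintro _ ⟨⟨a, n⟩, rfl⟩
      exact ⟨((α ^ (-n)) (star a), -n), Prod.ext (regularOp_star ρ α a n).symm
        (regularOp_star π α a n).symm⟩
  have h1 : p ∈ e ⁻¹' Set.range J :=
    closure_minimal (fun q hq => hS.subset (hle hq)) (hcl.preimage e.continuous) hp
  obtain ⟨a, ha⟩ := h1
  exact ⟨a, congrArg Prod.fst ha, congrArg Prod.snd ha⟩

lemma snd_eq_of_fst_eq (hρ : Function.Injective ρ)
    {p q : (L2Z K →L[ℂ] L2Z K) × (L2Z H →L[ℂ] L2Z H)} (hp : p ∈ jointAlgebra α ρ π)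
    (hq : q ∈ jointAlgebra α ρ π) (h : p.1 = q.1) : p.2 = q.2 := by
  refine sub_eq_zero.1 (eq_zero_of_entry_eq_zero fun k l => ?_)
  obtain ⟨a, h1, h2⟩ := exists_entry_eq hρ (sub_mem hp hq) k l
  rw [Prod.fst_sub, h, sub_self, map_zero] at h1
  have h3 : a = 0 := hρ (h1.trans (map_zero ρ).symm)
  rw [← Prod.snd_sub, ← h2, h3, map_zero]

lemma exists_mem_jointAlgebra (hρ : Function.Injective ρ) (X : reducedCrossedProduct ρ α) :
    ∃ Y, ((X : L2Z K →L[ℂ] L2Z K), Y) ∈ jointAlgebra α ρ π := by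
  let f : jointAlgebra α ρ π →⋆ₙₐ[ℂ] (L2Z K →L[ℂ] L2Z K) :=
    (NonUnitalStarAlgHom.fst ℂ (L2Z K →L[ℂ] L2Z K) (L2Z H →L[ℂ] L2Z H)).comp
      (NonUnitalStarSubalgebraClass.subtype (jointAlgebra α ρ π))
  have hf : Function.Injective f := fun p q h =>
    Subtype.ext (Prod.ext h (snd_eq_of_fst_eq hρ p.2 q.2 h))
  have hcl : IsClosed (Set.range f) :=
    (NonUnitalStarAlgHom.isometry f hf).isClosedEmbedding.isClosed_range
  have hle : NonUnitalStarAlgebra.adjoin ℂ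
      (Set.range fun an : A × ℤ => regularOp ρ α an.1 an.2) ≤ NonUnitalStarAlgHom.range f := by
    refine NonUnitalStarAlgebra.adjoin_le ?_
    rintro _ ⟨an, rfl⟩
    refine ⟨⟨_, NonUnitalStarSubalgebra.le_topologicalClosure _
      (NonUnitalStarAlgebra.subset_adjoin ℂ _ ⟨an, rfl⟩)⟩, rfl⟩
  have h1 : (X : L2Z K →L[ℂ] L2Z K) ∈ Set.range f :=
    closure_minimal (fun T hT => (NonUnitalStarAlgHom.mem_range f).1 (hle hT)) hcl X.2
  obtain ⟨p, hp⟩ := h1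
  refine ⟨p.1.2, ?_⟩
  rw [← hp]
  exact p.2

/-- A star subalgebra of `B₁ × B₂` which is the graph of a function on `S` is the graph of a
homomorphism on `S`. -/
lemma exists_starAlgHom_of_graph {B₁ B₂ : Type*} [NonUnitalCStarAlgebra B₁]
    [NonUnitalCStarAlgebra B₂] (S : NonUnitalStarSubalgebra ℂ B₁)
    (C : NonUnitalStarSubalgebra ℂ (B₁ × B₂)) (hex : ∀ X : S, ∃ Y, ((X : B₁), Y) ∈ C)
    (huniq : ∀ p ∈ C, ∀ q ∈ C, p.1 = q.1 → p.2 = q.2) :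
    ∃ Ψ : S →⋆ₙₐ[ℂ] B₂, ∀ (X : S) (Y : B₂), ((X : B₁), Y) ∈ C → Ψ X = Y := by
  choose Y hY using hex
  have h : ∀ (X : S) (Z : B₂), ((X : B₁), Z) ∈ C → Y X = Z := fun X Z hZ =>
    huniq _ (hY X) _ hZ rfl
  exact ⟨{ toFun := Y
           map_smul' := fun c X => h _ _ (C.smul_mem c (hY X))
           map_zero' := h _ _ C.zero_mem
           map_add' := fun X X' => h _ _ (C.add_mem (hY X) (hY X'))
           map_mul' := fun X X' => h _ _ (C.mul_mem (hY X) (hY X'))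
           map_star' := fun X => h _ _ (star_mem (s := C) (hY X)) }, h⟩

/-- The regular representation induced by `π` factors through the reduced crossed product, even when
`π` is not faithful. -/
theorem exists_regular_representation (hρ : Function.Injective ρ) :
    ∃ Ψ : reducedCrossedProduct ρ α →⋆ₙₐ[ℂ] (L2Z H →L[ℂ] L2Z H),
      ∀ a n, Ψ (crossedElem ρ α a n) = regularOp π α a n := by
  obtain ⟨Ψ, hΨ⟩ := exists_starAlgHom_of_graph (reducedCrossedProduct ρ α) (jointAlgebra α ρ π)
    (exists_mem_jointAlgebra hρ) fun _ hp _ hq => snd_eq_of_fst_eq hρ hp hq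
  exact ⟨Ψ, fun a n => hΨ _ _ (NonUnitalStarSubalgebra.le_topologicalClosure _
    (NonUnitalStarAlgebra.subset_adjoin ℂ _ ⟨(a, n), rfl⟩))⟩

/-- A subspace of the reduced crossed product is dense if it contains `a ⊗ Vⁿ` for all `n` and all
`a` in a dense set: the closed span of all `a ⊗ Vⁿ` is already a C⋆-algebra. -/
lemma dense_of_crossedElem_mem {A' : Set A} (hA' : Dense A')
    (P : Submodule ℂ (reducedCrossedProduct ρ α))
    (hP : ∀ a ∈ A', ∀ n, crossedElem ρ α a n ∈ P) :
    Dense (P : Set (reducedCrossedProduct ρ α)) := by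
  have h1 : ∀ a n, crossedElem ρ α a n ∈ P.topologicalClosure := by
    intro a n
    have hc : Continuous fun a => crossedElem ρ α a n :=
      (regularOpCLM ρ α n).continuous.subtype_mk _
    have h2 : IsClosed {a | crossedElem ρ α a n ∈ P.topologicalClosure} :=
      P.isClosed_topologicalClosure.preimage hc
    exact h2.closure_subset_iff.2 (fun b hb => P.le_topologicalClosure (hP b hb n)) (hA' a)
  let i : reducedCrossedProduct ρ α →ₗ[ℂ] (L2Z K →L[ℂ] L2Z K) :=
    (reducedCrossedProduct ρ α).toSubmodule.subtype
  have hle : (NonUnitalStarAlgebra.adjoin ℂ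
      (Set.range fun an : A × ℤ => regularOp ρ α an.1 an.2)).toSubmodule ≤
        P.topologicalClosure.map i := by
    rw [adjoin_eq_span_of_closed, Submodule.span_le]
    · rintro _ ⟨⟨a, n⟩, rfl⟩
      exact ⟨crossedElem ρ α a n, h1 a n, rfl⟩
    · rintro _ ⟨⟨a, n⟩, rfl⟩ _ ⟨⟨b, m⟩, rfl⟩
      exact ⟨(a * (α ^ n) b, n + m), (regularOp_mul ρ α a b n m).symm⟩
    · rintro _ ⟨⟨a, n⟩, rfl⟩
      exact ⟨((α ^ (-n)) (star a), -n), (regularOp_star ρ α a n).symm⟩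
  intro X
  change X ∈ P.topologicalClosure
  rw [← SetLike.mem_coe, ← P.isClosed_topologicalClosure.closure_eq, closure_subtype]
  exact closure_mono hle X.2

end Representation

/-! ### Diagonal operators on `L ⊕ L` -/

section Double

variable {L : Type*} [NormedAddCommGroup L] [InnerProductSpace ℂ L]

@[simp]
lemma diagonal_apply (S T : L →L[ℂ] L) (v : Double L) :
    diagonal S T v = WithLp.toLp 2 (S v.fst, T v.snd) := rfl

/-- The diagonal representation `T ↦ T ⊕ T`. -/
def diagonalHom (L : Type*) [NormedAddCommGroup L] [InnerProductSpace ℂ L] [CompleteSpace L] :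
    (L →L[ℂ] L) →⋆ₙₐ[ℂ] (Double L →L[ℂ] Double L) where
  toFun T := diagonal T T
  map_smul' _ _ := rfl
  map_zero' := rfl
  map_add' _ _ := rfl
  map_mul' _ _ := rfl
  map_star' T := by
    refine (ContinuousLinearMap.eq_adjoint_iff _ _).2 fun v w => ?_
    simp only [diagonal_apply, WithLp.prod_inner_apply]
    exact congrArg₂ (· + ·) (ContinuousLinearMap.adjoint_inner_left _ _ _)
      (ContinuousLinearMap.adjoint_inner_left _ _ _)

lemma norm_le_of_fst_snd {L : Type*} [NormedAddCommGroup L] {C : ℝ} {v w : Double L}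
    (hC : 0 ≤ C) (h1 : ‖v.fst‖ ≤ C * ‖w.fst‖)
    (h2 : ‖v.snd‖ ≤ C * ‖w.snd‖) : ‖v‖ ≤ C * ‖w‖ := by
  refine (pow_le_pow_iff_left₀ (norm_nonneg _) (by positivity) two_ne_zero).1 ?_
  rw [mul_pow, WithLp.prod_norm_sq_eq_of_L2, WithLp.prod_norm_sq_eq_of_L2, mul_add, ← mul_pow,
    ← mul_pow]
  gcongr

lemma norm_diagonal_le {C : ℝ} (hC : 0 ≤ C) {S T : L →L[ℂ] L} (hS : ‖S‖ ≤ C) (hT : ‖T‖ ≤ C) :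
    ‖diagonal S T‖ ≤ C :=
  ContinuousLinearMap.opNorm_le_bound _ hC fun _ =>
    norm_le_of_fst_snd hC (S.le_of_opNorm_le hS _) (T.le_of_opNorm_le hT _)

open scoped ComplexOrder in
lemma isPositive_diagonal {S T : L →L[ℂ] L} (hS : S.IsPositive) (hT : T.IsPositive) :
    (diagonal S T).IsPositive := by
  refine (ContinuousLinearMap.isPositive_iff _).2 ⟨fun v w => ?_, fun v => ?_⟩
  · change ⟪diagonal S T v, w⟫_ℂ = ⟪v, diagonal S T w⟫_ℂ
    simp only [diagonal_apply, WithLp.prod_inner_apply]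
    exact congrArg₂ (· + ·) (hS.inner_left_eq_inner_right _ _) (hT.inner_left_eq_inner_right _ _)
  · rw [diagonal_apply, WithLp.prod_inner_apply]
    exact add_nonneg (hS.inner_nonneg_left _) (hT.inner_nonneg_left _)

/-- Block diagonal operators, written through the coordinate embeddings and projections. -/
lemma exists_diagonal_eq (L : Type*) [NormedAddCommGroup L] [InnerProductSpace ℂ L] :
    ∃ (i j : L →L[ℂ] Double L) (p q : Double L →L[ℂ] L), ∀ S T : L →L[ℂ] L,
      diagonal S T = i ∘L S ∘L p + j ∘L T ∘L q := by
  let e := WithLp.prodContinuousLinearEquiv 2 ℂ L L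
  refine ⟨(e.symm : L × L →L[ℂ] Double L) ∘L .inl ℂ L L,
    (e.symm : L × L →L[ℂ] Double L) ∘L .inr ℂ L L,
    .fst ℂ L L ∘L (e : Double L →L[ℂ] L × L), .snd ℂ L L ∘L (e : Double L →L[ℂ] L × L),
    fun S T => ?_⟩
  ext1 v
  change WithLp.toLp 2 (S v.fst, T v.snd) =
    WithLp.toLp 2 (S v.fst, (0 : L)) + WithLp.toLp 2 ((0 : L), T v.snd)
  rw [← WithLp.toLp_add, Prod.mk_add_mk, add_zero, zero_add]

lemma isCompactOperator_diagonal {S T : L →L[ℂ] L} (hS : IsCompactOperator S)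
    (hT : IsCompactOperator T) : IsCompactOperator (diagonal S T) := by
  obtain ⟨i, j, p, q, h⟩ := exists_diagonal_eq L
  rw [h]
  exact ((hS.comp_clm p).clm_comp i).add ((hT.comp_clm q).clm_comp j)

lemma rank_diagonal_le {S T : L →L[ℂ] L} {m n : ℕ} (hS : (S : L →ₗ[ℂ] L).rank ≤ m)
    (hT : (T : L →ₗ[ℂ] L).rank ≤ n) :
    (diagonal S T : Double L →ₗ[ℂ] Double L).rank ≤ (m + n : ℕ) := by
  obtain ⟨i, j, p, q, h⟩ := exists_diagonal_eq L
  rw [h]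
  have key : ∀ (i : L →L[ℂ] Double L) (p : Double L →L[ℂ] L) (S : L →L[ℂ] L),
      ((i ∘L S ∘L p : Double L →L[ℂ] Double L) : Double L →ₗ[ℂ] Double L).rank ≤
        (S : L →ₗ[ℂ] L).rank := fun i p S =>
    (LinearMap.rank_comp_le_right ((S : L →ₗ[ℂ] L).comp (p : Double L →ₗ[ℂ] L))
      (i : L →ₗ[ℂ] Double L)).trans (LinearMap.rank_comp_le_left _ _)
  refine (LinearMap.rank_add_le (i ∘L S ∘L p : Double L →L[ℂ] Double L).toLinearMap
    (j ∘L T ∘L q : Double L →L[ℂ] Double L).toLinearMap).trans ?_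
  push_cast
  exact add_le_add ((key i p S).trans hS) ((key j q T).trans hT)

/-- The flip `(x, y) ↦ (y, x)` of `L ⊕ L`. -/
def swapDouble (L : Type*) [NormedAddCommGroup L] [InnerProductSpace ℂ L] :
    Double L →L[ℂ] Double L :=
  ((WithLp.prodContinuousLinearEquiv 2 ℂ L L).symm : L × L →L[ℂ] Double L) ∘L
    (ContinuousLinearEquiv.prodComm ℂ L L : L × L →L[ℂ] L × L) ∘L
    (WithLp.prodContinuousLinearEquiv 2 ℂ L L : Double L →L[ℂ] L × L)

lemma separableSpace_double {L : Type*} [NormedAddCommGroup L]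
    [TopologicalSpace.SeparableSpace L] : TopologicalSpace.SeparableSpace (Double L) := by
  rw [← TopologicalSpace.isSeparable_univ_iff]
  refine ((TopologicalSpace.IsSeparable.of_separableSpace
    (Set.univ : Set (L × L))).image (WithLp.prod_continuous_toLp 2 L L)).mono fun v _ => ?_
  exact ⟨v.ofLp, trivial, rfl⟩

end Double

/-! ### Commutators with the Dirac operator -/

section Commutator

variable {A : Type*} [NonUnitalCStarAlgebra A] {α : A ≃⋆ₐ[ℂ] A}
  {H : Type*} [NormedAddCommGroup H] [InnerProductSpace ℂ H] [CompleteSpace H]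
  {π : A →⋆ₙₐ[ℂ] (H →L[ℂ] H)} {D : H →ₗ.[ℂ] H}

/-- In the fibre over `k`, the commutator of `D ⊗ 1 - s i ⊗ ∂` with `a ⊗ Vⁿ` is
`[D, π(αᵏ(a))] - s i n π(αᵏ(a))`. -/
lemma FiberGraph.exists_regularOp {a : A} {C : ℝ}
    (hC : ∀ k : ℤ, CommutatorBoundedBy D (π ((α ^ k) a)) C) (n : ℤ) {s : ℝ} (hs : s ^ 2 = 1)
    {x y : L2Z H} (h : FiberGraph D s x y) :
    ∃ z, FiberGraph D s (regularOp π α a n x) z ∧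
      ‖z - regularOp π α a n y‖ ≤ (|C| + |(n : ℝ)| * ‖a‖) * ‖x‖ := by
  have h1 := fun k : ℤ => commutatorBoundedBy_iff_graph.1 (hC k) _ _ (h (k + n))
  choose d hd hd' using h1
  set u : ℤ → H := fun k => d k + (((s * k : ℝ) : ℂ) * Complex.I) • regularOp π α a n x k -
    regularOp π α a n y k
  have hs' : |s| = 1 := by
    rw [← sq_eq_sq₀ (abs_nonneg s) zero_le_one, sq_abs, hs, one_pow]
  have hu : ∀ k, ‖u k‖ ≤ (|C| + |(n : ℝ)| * ‖a‖) * ‖x (k + n)‖ := by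
    intro k
    have e : u k = (d k - π ((α ^ k) a) (y (k + n) -
        (((s * (k + n : ℤ) : ℝ) : ℂ) * Complex.I) • x (k + n))) -
        (((s * n : ℝ) : ℂ) * Complex.I) • π ((α ^ k) a) (x (k + n)) := by
      simp only [u, regularOp_apply, map_sub, map_smul]
      push_cast
      module
    rw [e, add_mul]
    refine (norm_sub_le _ _).trans (add_le_add ((hd' k).trans ?_) ?_)
    · gcongr
      exact le_abs_self C
    · rw [norm_smul, norm_mul, Complex.norm_I, mul_one, Complex.norm_real, Real.norm_eq_abs,
        abs_mul, hs', one_mul, mul_assoc]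
      gcongr
      exact regular_norm_le π α a k _
  have hmem : Memℓp u 2 := by
    refine memℓp_two_iff.2 (Summable.of_nonneg_of_le (fun _ => by positivity) (fun k => ?_)
      ((regular_hasSum x n).summable.mul_left ((|C| + |(n : ℝ)| * ‖a‖) ^ 2)))
    rw [← mul_pow]
    exact pow_le_pow_left₀ (norm_nonneg _) (hu k) 2
  let U : L2Z H := ⟨u, hmem⟩
  refine ⟨U + regularOp π α a n y, fun k => ?_, ?_⟩
  · have e : (U + regularOp π α a n y) k -
        (((s * k : ℝ) : ℂ) * Complex.I) • regularOp π α a n x k = d k := by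
      change u k + regularOp π α a n y k - _ = d k
      simp only [u]
      abel
    rw [e]
    exact hd k
  · rw [add_sub_cancel_right]
    exact norm_le_mul_of_forall_norm_le (by positivity) (Equiv.addRight n) hu

lemma commutatorBoundedBy_crossedDirac (hD : IsSelfAdjoint D) {a : A} {C : ℝ}
    (hC : ∀ k : ℤ, CommutatorBoundedBy D (π ((α ^ k) a)) C) (n : ℤ) :
    CommutatorBoundedBy (crossedDirac D)
      (diagonal (regularOp π α a n) (regularOp π α a n)) (|C| + |(n : ℝ)| * ‖a‖) := by
  rw [commutatorBoundedBy_iff_graph]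
  intro v w hvw
  obtain ⟨h1, h2⟩ := (mem_crossedDirac_graph hD).1 hvw
  obtain ⟨z1, hz1, hz1'⟩ := h1.exists_regularOp hC n (by norm_num)
  obtain ⟨z2, hz2, hz2'⟩ := h2.exists_regularOp hC n (by norm_num)
  refine ⟨WithLp.toLp 2 (z1, z2), (mem_crossedDirac_graph hD).2 ⟨hz1, hz2⟩, ?_⟩
  -- the two components of `v` are exchanged by the Dirac operator
  have h3 : ‖(WithLp.toLp 2 (v.snd, v.fst) : Double (L2Z H))‖ = ‖v‖ := by
    rw [← sq_eq_sq₀ (norm_nonneg _) (norm_nonneg _), WithLp.prod_norm_sq_eq_of_L2,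
      WithLp.prod_norm_sq_eq_of_L2]
    exact add_comm _ _
  rw [← h3]
  exact norm_le_of_fst_snd (by positivity) hz1' hz2'

end Commutator

/-! ### The inverse of `1 + 𝒟²` and its square root -/

section Inverse

variable {H : Type*} [NormedAddCommGroup H] [InnerProductSpace ℂ H] {D : H →ₗ.[ℂ] H}

section Fibre

variable {R G Q : H →L[ℂ] H} {k s : ℝ}

/-- `D (1 + D² + k²)⁻¹ + s i k (1 + D² + k²)⁻¹`, written with `R = (1 + D²)⁻¹`, `G = D R` and
`Q = (1 + k² R)⁻¹`. -/
def fibreComp (R G Q : H →L[ℂ] H) (k s : ℝ) : H →L[ℂ] H :=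
  G ∘L Q + (((s * k : ℝ) : ℂ) * Complex.I) • (R ∘L Q)

lemma fibreComp_apply (x : H) : fibreComp R G Q k s x =
    G (Q x) + (((s * k : ℝ) : ℂ) * Complex.I) • R (Q x) := rfl

/-- `(D + s i k) (1 + D² + k²)⁻¹ = fibreComp`. -/
lemma mem_graph_fibreComp (hG : ∀ x, (R x, G x) ∈ D.graph ∧ (G x, x - R x) ∈ D.graph) (x : H) :
    (R (Q x), fibreComp R G Q k s x - (((s * k : ℝ) : ℂ) * Complex.I) • R (Q x)) ∈ D.graph := by
  rw [fibreComp_apply, add_sub_cancel_right]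
  exact (hG _).1

/-- `(D - s i k) (D + s i k) (1 + D² + k²)⁻¹ = 1 - (1 + D² + k²)⁻¹`. -/
lemma fibreComp_mem_graph (hG : ∀ x, (R x, G x) ∈ D.graph ∧ (G x, x - R x) ∈ D.graph)
    (hs : s ^ 2 = 1) (hQ : Q + ((k ^ 2 : ℝ) : ℂ) • (R ∘L Q) = 1) (x : H) :
    (fibreComp R G Q k s x, x - R (Q x) -
      (((-s * k : ℝ) : ℂ) * Complex.I) • fibreComp R G Q k s x) ∈ D.graph := by
  have h1 := D.graph.add_mem (hG (Q x)).2
    (D.graph.smul_mem (((s * k : ℝ) : ℂ) * Complex.I) (hG (Q x)).1)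
  convert h1 using 1
  rw [Prod.smul_mk, Prod.mk_add_mk, ← fibreComp_apply]
  congr 1
  have h2 : Q x + ((k ^ 2 : ℝ) : ℂ) • R (Q x) = x := congrArg (fun T : H →L[ℂ] H => T x) hQ
  have h3 : (((-s * k : ℝ) : ℂ) * Complex.I) * (((s * k : ℝ) : ℂ) * Complex.I) =
      ((k ^ 2 : ℝ) : ℂ) := by
    have h4 : (s : ℂ) ^ 2 = 1 := by exact_mod_cast hs
    push_cast
    linear_combination (-(s : ℂ) ^ 2 * (k : ℂ) ^ 2) * Complex.I_sq + (k : ℂ) ^ 2 * h4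
  rw [fibreComp_apply, smul_add, smul_smul, h3, sub_sub, add_left_comm, ← sub_sub]
  nth_rewrite 1 [← h2]
  push_cast
  module

/-- Pairing `x` with `r = (1 + D² + k²)⁻¹ x` gives `‖r‖² + ‖D r‖² + k² ‖r‖² ≤ ‖x‖ ‖r‖`, from which
the bounds follow. -/
lemma fibreComp_bounds (hD : D.IsFormalAdjoint D)
    (hG : ∀ x, (R x, G x) ∈ D.graph ∧ (G x, x - R x) ∈ D.graph)
    (hs : s ^ 2 = 1) (hQ : Q + ((k ^ 2 : ℝ) : ℂ) • (R ∘L Q) = 1) (x : H) :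
    ‖R (Q x)‖ ≤ ‖x‖ ∧ k ^ 2 * ‖R (Q x)‖ ≤ ‖x‖ ∧ ‖fibreComp R G Q k s x‖ ^ 2 ≤ ‖x‖ * ‖R (Q x)‖ := by
  have h2 : Q x + ((k ^ 2 : ℝ) : ℂ) • R (Q x) = x := congrArg (fun T : H →L[ℂ] H => T x) hQ
  have h3 := inner_invOneAddSq hD (hG (Q x)).1 (hG (Q x)).2
  have h4 : ⟪x, R (Q x)⟫_ℂ =
      ((‖R (Q x)‖ ^ 2 + (‖G (Q x)‖ ^ 2 + k ^ 2 * ‖R (Q x)‖ ^ 2) : ℝ) : ℂ) := by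
    have h5 : ⟪R (Q x), R (Q x)⟫_ℂ = ((‖R (Q x)‖ ^ 2 : ℝ) : ℂ) := by
      rw [inner_self_eq_norm_sq_to_K]
      push_cast
      rfl
    nth_rewrite 1 [← h2]
    rw [inner_add_left, inner_smul_left, h3, h5, Complex.conj_ofReal]
    push_cast
    ring
  have h5 : ‖R (Q x)‖ ^ 2 + (‖G (Q x)‖ ^ 2 + k ^ 2 * ‖R (Q x)‖ ^ 2) ≤ ‖x‖ * ‖R (Q x)‖ := by
    have h6 := norm_inner_le_norm (𝕜 := ℂ) x (R (Q x))
    rwa [h4, Complex.norm_real, Real.norm_of_nonneg (by positivity)] at h6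
  have h6 : ‖fibreComp R G Q k s x‖ ^ 2 = ‖G (Q x)‖ ^ 2 + k ^ 2 * ‖R (Q x)‖ ^ 2 := by
    rw [fibreComp_apply, norm_sq_add_smul hD (hG _).1, mul_pow, hs, one_mul]
  have h7 : 0 ≤ k ^ 2 * ‖R (Q x)‖ ^ 2 := by positivity
  refine ⟨?_, ?_, ?_⟩
  · rcases (norm_nonneg (R (Q x))).eq_or_lt with h | h
    · rw [← h]; positivity
    · refine le_of_mul_le_mul_right ?_ h
      nlinarith [sq_nonneg ‖G (Q x)‖]
  · rcases (norm_nonneg (R (Q x))).eq_or_lt with h | h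
    · rw [← h, mul_zero]; positivity
    · refine le_of_mul_le_mul_right ?_ h
      nlinarith [sq_nonneg ‖G (Q x)‖, sq_nonneg ‖R (Q x)‖]
  · rw [h6]
    nlinarith [sq_nonneg ‖R (Q x)‖]

lemma norm_fibre_le (hD : D.IsFormalAdjoint D)
    (hG : ∀ x, (R x, G x) ∈ D.graph ∧ (G x, x - R x) ∈ D.graph)
    (hs : s ^ 2 = 1) (hQ : Q + ((k ^ 2 : ℝ) : ℂ) • (R ∘L Q) = 1) :
    ‖R ∘L Q‖ ≤ 1 ∧ |k| * ‖R ∘L Q‖ ≤ 1 ∧ ‖fibreComp R G Q k s‖ ≤ 1 ∧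
      |k| * ‖fibreComp R G Q k s‖ ≤ 1 := by
  have key : ∀ (T : H →L[ℂ] H) (c : ℝ), (∀ x, (c * ‖T x‖) ^ 2 ≤ ‖x‖ ^ 2) → |c| * ‖T‖ ≤ 1 := by
    intro T c hT
    have h : ‖(c : ℂ) • T‖ ≤ 1 := by
      refine ContinuousLinearMap.opNorm_le_bound _ zero_le_one fun x => ?_
      rw [one_mul]
      have h1 : ‖((c : ℂ) • T) x‖ = |c| * ‖T x‖ := by
        rw [_root_.smul_apply, norm_smul, Complex.norm_real, Real.norm_eq_abs]
      rw [h1, ← sq_le_sq₀ (by positivity) (norm_nonneg _), mul_pow, sq_abs, ← mul_pow]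
      exact hT x
    rwa [norm_smul, Complex.norm_real, Real.norm_eq_abs] at h
  have b := fibreComp_bounds hD hG hs hQ
  refine ⟨?_, key _ _ fun x => ?_, ?_, key _ _ fun x => ?_⟩
  · refine ContinuousLinearMap.opNorm_le_bound _ zero_le_one fun x => ?_
    rw [one_mul]
    exact (b x).1
  · obtain ⟨h1, h2, h3⟩ := b x
    change (k * ‖R (Q x)‖) ^ 2 ≤ _
    nlinarith [mul_le_mul h1 h2 (by positivity) (norm_nonneg _)]
  · have h := key (fibreComp R G Q k s) 1 fun x => ?_
    · simpa using h
    · obtain ⟨h1, h2, h3⟩ := b x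
      nlinarith [mul_le_mul_of_nonneg_left h1 (norm_nonneg x)]
  · obtain ⟨h1, h2, h3⟩ := b x
    nlinarith [mul_le_mul_of_nonneg_left h2 (norm_nonneg x),
      mul_le_mul_of_nonneg_left h3 (sq_nonneg k)]

end Fibre

variable [CompleteSpace H]

/-- From `T = (1 + D²)^{-1/2}` one obtains `(1 + 𝒟²)^{-1/2}` as the direct sum of two copies of
`⨁ₖ T S k = ⨁ₖ (1 + D² + k²)^{-1/2}`, with contractions `S k`. -/
theorem exists_crossed_inverse (hD : IsSelfAdjoint D) {T : H →L[ℂ] H} (hT : T.IsPositive)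
    (hinv : IsInvOneAddSq D (T ∘L T)) :
    ∃ (S : ℤ → H →L[ℂ] H) (hB : ∀ k, ‖T ∘L S k‖ ≤ ‖T‖) (𝒯 𝒢 : Double (L2Z H) →L[ℂ] Double (L2Z H)),
      𝒯 = diagonal (lpDiag (fun k => T ∘L S k) hB) (lpDiag (fun k => T ∘L S k) hB) ∧
      (∀ k, ‖S k‖ ≤ 1) ∧ (∀ k : ℤ, |(k : ℝ)| * ‖T ∘L S k‖ ≤ 1) ∧ 𝒯.IsPositive ∧
      (∀ v, ((𝒯 ∘L 𝒯) v, 𝒢 v) ∈ (crossedDirac D).graph ∧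
        (𝒢 v, v - (𝒯 ∘L 𝒯) v) ∈ (crossedDirac D).graph) ∧
      (HasCompactResolvent D → IsCompactOperator (𝒯 ∘L 𝒯) ∧ IsCompactOperator 𝒢) := by
  have hsym := isFormalAdjoint_self hD
  have hT0 : 0 ≤ T := (ContinuousLinearMap.nonneg_iff_isPositive T).2 hT
  obtain ⟨G, hG⟩ := hinv.exists_comp hsym
  choose S Q hpos hS hTS hsq hQ using fun k : ℤ => exists_fiber hT0 (k : ℝ)
  have hQ' : ∀ k : ℤ, Q k + (((k : ℝ) ^ 2 : ℝ) : ℂ) • ((T ∘L T) ∘L Q k) = 1 := hQ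
  have hB : ∀ k, ‖T ∘L S k‖ ≤ ‖T‖ := fun k =>
    (ContinuousLinearMap.opNorm_comp_le _ _).trans
      (mul_le_of_le_one_right (norm_nonneg _) (hS k))
  have hs1 : ((1 : ℝ)) ^ 2 = 1 := by norm_num
  have hs2 : ((-1 : ℝ)) ^ 2 = 1 := by norm_num
  have b1 := fun k : ℤ => norm_fibre_le hsym hG hs1 (hQ' k)
  have b2 := fun k : ℤ => norm_fibre_le hsym hG hs2 (hQ' k)
  set P := lpDiag (fun k : ℤ => fibreComp (T ∘L T) G (Q k) k 1) (fun k => (b1 k).2.2.1)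
  set M := lpDiag (fun k : ℤ => fibreComp (T ∘L T) G (Q k) k (-1)) (fun k => (b2 k).2.2.1)
  set 𝒯 := diagonal (lpDiag (fun k => T ∘L S k) hB) (lpDiag (fun k => T ∘L S k) hB)
  have hsq' : 𝒯 ∘L 𝒯 = diagonal (lpDiag (fun k => (T ∘L T) ∘L Q k) (fun k => (b1 k).1))
      (lpDiag (fun k => (T ∘L T) ∘L Q k) (fun k => (b1 k).1)) := by
    have h1 : lpDiag (fun k => T ∘L S k) hB ∘L lpDiag (fun k => T ∘L S k) hB =
        lpDiag (fun k => (T ∘L T) ∘L Q k) (fun k => (b1 k).1) := by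
      ext ξ k
      exact congrArg (fun U : H →L[ℂ] H => U (ξ k)) (hsq k)
    rw [← h1]
    rfl
  refine ⟨S, hB, 𝒯, swapDouble (L2Z H) ∘L diagonal M P, rfl, hS, hTS, ?_, fun v => ?_, fun hc => ?_⟩
  · have h1 : (lpDiag (fun k => T ∘L S k) hB).IsPositive := isPositive_lpDiag hB fun k =>
      (ContinuousLinearMap.nonneg_iff_isPositive _).1 (hpos k)
    exact isPositive_diagonal h1 h1
  · rw [hsq', mem_crossedDirac_graph hD, mem_crossedDirac_graph hD]
    refine ⟨⟨fun k => mem_graph_fibreComp hG _, fun k => mem_graph_fibreComp hG _⟩,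
      ⟨fun k => ?_, fun k => ?_⟩⟩
    · have h1 := fibreComp_mem_graph hG hs2 (hQ' k) (v.fst k)
      rw [neg_neg] at h1
      exact h1
    · exact fibreComp_mem_graph hG hs1 (hQ' k) (v.snd k)
  · obtain ⟨c1, c2⟩ := isCompactOperator_of_hasCompactResolvent hc hG
    have c3 : ∀ (k : ℤ) (s : ℝ), IsCompactOperator (fibreComp (T ∘L T) G (Q k) k s) := fun k s =>
      (c2.comp_clm (Q k)).add ((c1.comp_clm (Q k)).smul _)
    rw [hsq']
    have c4 := isCompactOperator_lpDiag (fun k => (b1 k).1) (fun k => c1.comp_clm (Q k))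
      fun k => (b1 k).2.1
    have cP : IsCompactOperator P :=
      isCompactOperator_lpDiag (fun k => (b1 k).2.2.1) (fun k => c3 k 1) fun k => (b1 k).2.2.2
    have cM : IsCompactOperator M :=
      isCompactOperator_lpDiag (fun k => (b2 k).2.2.1) (fun k => c3 k (-1)) fun k => (b2 k).2.2.2
    exact ⟨isCompactOperator_diagonal c4 c4,
      (isCompactOperator_diagonal cM cP).clm_comp (swapDouble (L2Z H))⟩

end Inverse

/-! ### Singular numbers -/

section Summability

variable {H : Type*} [NormedAddCommGroup H] [InnerProductSpace ℂ H]

lemma singularNumber_le {T F : H →L[ℂ] H} {n : ℕ} (hF : (F : H →ₗ[ℂ] H).rank ≤ n) :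
    singularNumber T n ≤ ‖T - F‖ :=
  csInf_le ⟨0, by rintro _ ⟨F, -, rfl⟩; exact norm_nonneg _⟩ ⟨F, hF, rfl⟩

lemma exists_norm_sub_le_of_singularNumber_lt {T : H →L[ℂ] H} {n : ℕ} {r : ℝ}
    (h : singularNumber T n < r) :
    ∃ F : H →L[ℂ] H, (F : H →ₗ[ℂ] H).rank ≤ n ∧ ‖T - F‖ ≤ r := by
  have hne : {r : ℝ | ∃ F : H →L[ℂ] H, (F : H →ₗ[ℂ] H).rank ≤ n ∧ r = ‖T - F‖}.Nonempty :=
    ⟨_, 0, by simp, rfl⟩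
  obtain ⟨_, ⟨F, hF, rfl⟩, hlt⟩ := exists_lt_of_csInf_lt hne h
  exact ⟨F, hF, hlt.le⟩

lemma diagonal_sub_diagonal (S T S' T' : H →L[ℂ] H) :
    diagonal S T - diagonal S' T' = diagonal (S - S') (T - T') := rfl

lemma singularNumber_diagonal_self_le {T W : H →L[ℂ] H} {r n : ℕ} {ε : ℝ} (hε : 0 ≤ ε)
    (hW : (W : H →ₗ[ℂ] H).rank ≤ r) (hn : r + r ≤ n) (hTW : ‖T - W‖ ≤ ε) :
    singularNumber (diagonal T T) n ≤ ε := by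
  have hrank := (rank_diagonal_le hW hW).trans (Nat.cast_le.2 hn)
  refine (singularNumber_le (T := diagonal T T) hrank).trans ?_
  rw [diagonal_sub_diagonal]
  exact norm_diagonal_le hε hTW hTW

/-- If `F` has rank at most `m` and is close to `T`, then `⨁ₖ T S k` is approximated by
`⨁ F S k`, the sum being over `|k| ≤ N`. -/
lemma singularNumber_diagonal_le {T F : H →L[ℂ] H} {S : ℤ → H →L[ℂ] H} (hS : ∀ k, ‖S k‖ ≤ 1)
    {C : ℝ} (hB : ∀ k, ‖T ∘L S k‖ ≤ C) {m N n : ℕ} {ε : ℝ} (hF : (F : H →ₗ[ℂ] H).rank ≤ m)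
    (hTF : ‖T - F‖ ≤ ε) (hN : ∀ k : ℤ, (N : ℝ) + 1 ≤ |(k : ℝ)| → ‖T ∘L S k‖ ≤ ε)
    (hn : (2 * N + 1) * m + (2 * N + 1) * m ≤ n) :
    singularNumber (diagonal (lpDiag (fun k => T ∘L S k) hB) (lpDiag (fun k => T ∘L S k) hB)) n ≤
      ε := by
  set s : Finset ℤ := Finset.Icc (-(N : ℤ)) N
  set W := lpTrunc (fun k => F ∘L S k) s
  have hε : 0 ≤ ε := (norm_nonneg _).trans hTF
  have h1 : ∀ k ∈ s, ‖T ∘L S k - F ∘L S k‖ ≤ ε := by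
    intro k _
    rw [← ContinuousLinearMap.sub_comp]
    exact (ContinuousLinearMap.opNorm_comp_le _ _).trans
      ((mul_le_of_le_one_right (norm_nonneg _) (hS k)).trans hTF)
  have h2 : ∀ k ∉ s, ‖T ∘L S k‖ ≤ ε := by
    intro k hk
    rw [Finset.mem_Icc, ← abs_le, not_le] at hk
    exact hN k (by exact_mod_cast hk)
  have happrox : ‖lpDiag (fun k => T ∘L S k) hB - W‖ ≤ ε :=
    norm_lpDiag_sub_lpTrunc_le (B := fun k => T ∘L S k) (F := fun k => F ∘L S k) hB hε h1 h2
  have hrank : ∀ k, (F ∘L S k : H →ₗ[ℂ] H).rank ≤ m := fun k =>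
    (LinearMap.rank_comp_le_left (S k : H →ₗ[ℂ] H) (F : H →ₗ[ℂ] H)).trans hF
  have hrankW : (W : L2Z H →ₗ[ℂ] L2Z H).rank ≤ (s.card * m : ℕ) :=
    rank_lpTrunc_le (F := fun k => F ∘L S k) hrank s
  have hcard : s.card = 2 * N + 1 := by
    simp only [s, Int.card_Icc]
    omega
  exact singularNumber_diagonal_self_le hε hrankW (by rwa [hcard]) happrox

/-- If `μₘ(T) = O(m^{-1/p})`, then `⨁ₖ T S k` is approximated within `O(1/x)` by cutting off at
`|k| ≤ x` and replacing `T` by an operator of rank at most `x^p`: the total rank is `O(x^{p+1})`. -/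
theorem memWeakSchatten_diagonal {p : ℝ} (hp : 0 < p) {T : H →L[ℂ] H} (hT : MemWeakSchatten p T)
    {S : ℤ → H →L[ℂ] H} (hS : ∀ k, ‖S k‖ ≤ 1) (hTS : ∀ k : ℤ, |(k : ℝ)| * ‖T ∘L S k‖ ≤ 1)
    {C₀ : ℝ} (hB : ∀ k, ‖T ∘L S k‖ ≤ C₀) :
    MemWeakSchatten (p + 1)
      (diagonal (lpDiag (fun k => T ∘L S k) hB) (lpDiag (fun k => T ∘L S k) hB)) := by
  obtain ⟨C, hC⟩ := hT
  have hp1 : 0 < p + 1 := by linarith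
  set E := |C| + 1
  have hE1 : 1 ≤ E := le_add_of_nonneg_left (abs_nonneg C)
  refine ⟨E * 12 ^ (1 / (p + 1)), fun n => ?_⟩
  -- `x` is chosen such that `6 x ^ (p + 1) = (n + 1) / 2`
  set x : ℝ := (((n : ℝ) + 1) / 12) ^ (1 / (p + 1)) with hx
  have hn12 : 0 < ((n : ℝ) + 1) / 12 := by positivity
  have hx0 : 0 < x := Real.rpow_pos_of_pos hn12 _
  have hxp : x ^ (p + 1) = ((n : ℝ) + 1) / 12 := by
    rw [hx, ← Real.rpow_mul hn12.le, one_div_mul_cancel hp1.ne', Real.rpow_one]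
  set m := ⌊x ^ p⌋₊
  set N := ⌊x⌋₊
  have hxpp : 0 < x ^ p := Real.rpow_pos_of_pos hx0 p
  have hlt : singularNumber T m < E / x := by
    have h1 : 0 < ((m : ℝ) + 1) ^ (-(1 / p)) := Real.rpow_pos_of_pos (by positivity) _
    have h2 : ((m : ℝ) + 1) ^ (-(1 / p)) ≤ 1 / x := by
      have h3 : ((m : ℝ) + 1) ^ (-(1 / p)) ≤ (x ^ p) ^ (-(1 / p)) :=
        Real.rpow_le_rpow_of_nonpos hxpp (Nat.lt_floor_add_one _).le
          (neg_nonpos.2 (by positivity))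
      rwa [← Real.rpow_mul hx0.le, mul_neg, mul_one_div_cancel hp.ne', Real.rpow_neg_one,
        ← one_div] at h3
    calc singularNumber T m ≤ C * ((m : ℝ) + 1) ^ (-(1 / p)) := hC m
      _ < E * ((m : ℝ) + 1) ^ (-(1 / p)) := by
          gcongr
          exact (le_abs_self C).trans_lt (lt_add_one _)
      _ ≤ E * (1 / x) := by gcongr
      _ = E / x := by ring
  obtain ⟨F, hF, hTF⟩ := exists_norm_sub_le_of_singularNumber_lt hlt
  have hle : (2 * N + 1) * m + (2 * N + 1) * m ≤ n := by
    rcases lt_or_ge x 1 with hx1 | hx1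
    · have : m = 0 := Nat.floor_eq_zero.2 (Real.rpow_lt_one hx0.le hx1 hp)
      rw [this, mul_zero, add_zero]
      exact Nat.zero_le n
    · have h1 : (1 : ℝ) ≤ ((n : ℝ) + 1) / 12 := by
        rw [← hxp]
        exact Real.one_le_rpow hx1 hp1.le
      have h2 : (m : ℝ) ≤ x ^ p := Nat.floor_le hxpp.le
      have h3 : (N : ℝ) ≤ x := Nat.floor_le hx0.le
      have h4 : x ^ (p + 1) = x ^ p * x := by rw [Real.rpow_add hx0, Real.rpow_one]
      have h5 : ((2 * N + 1 : ℝ)) * m ≤ 3 * x * x ^ p := by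
        gcongr
        linarith
      have h6 : (((2 * N + 1) * m + (2 * N + 1) * m : ℕ) : ℝ) ≤ n := by
        push_cast
        nlinarith
      exact_mod_cast h6
  have h7 : E * 12 ^ (1 / (p + 1)) * ((n : ℝ) + 1) ^ (-(1 / (p + 1))) = E / x := by
    rw [hx, Real.div_rpow (by positivity) (by norm_num), Real.rpow_neg (by positivity)]
    field_simp
  rw [h7]
  refine singularNumber_diagonal_le hS hB hF hTF (fun k hk => ?_) hle
  have hk2 : x ≤ |(k : ℝ)| := (Nat.lt_floor_add_one x).le.trans hk
  rw [le_div_iff₀' hx0]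
  calc x * ‖T ∘L S k‖ ≤ |(k : ℝ)| * ‖T ∘L S k‖ := by gcongr
    _ ≤ 1 := hTS k
    _ ≤ E := hE1

end Summability

/-! ### The spectral triple on the crossed product -/

section Main

variable {H : Type*} [NormedAddCommGroup H] [InnerProductSpace ℂ H]

lemma CommutatorBoundedBy.add {D : H →ₗ.[ℂ] H} {S T : H →L[ℂ] H} {C C' : ℝ}
    (hS : CommutatorBoundedBy D S C) (hT : CommutatorBoundedBy D T C') :
    CommutatorBoundedBy D (S + T) (C + C') := by
  rw [commutatorBoundedBy_iff_graph] at *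
  intro x y h
  obtain ⟨z, hz, hz'⟩ := hS x y h
  obtain ⟨w, hw, hw'⟩ := hT x y h
  refine ⟨z + w, D.graph.add_mem hz hw, ?_⟩
  have e : z + w - (S + T) y = (z - S y) + (w - T y) := by
    rw [_root_.add_apply]
    abel
  rw [e, add_mul]
  exact (norm_add_le _ _).trans (add_le_add hz' hw')

lemma CommutatorBoundedBy.smul {D : H →ₗ.[ℂ] H} {T : H →L[ℂ] H} {C : ℝ}
    (hT : CommutatorBoundedBy D T C) (c : ℂ) : CommutatorBoundedBy D (c • T) (‖c‖ * C) := by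
  rw [commutatorBoundedBy_iff_graph] at *
  intro x y h
  obtain ⟨z, hz, hz'⟩ := hT x y h
  refine ⟨c • z, D.graph.smul_mem c hz, ?_⟩
  rw [_root_.smul_apply, ← smul_sub, norm_smul, mul_assoc]
  gcongr

lemma commutatorBoundedBy_zero (D : H →ₗ.[ℂ] H) : CommutatorBoundedBy D 0 0 := fun _ =>
  ⟨D.domain.zero_mem, by
    have h : D ⟨0, D.domain.zero_mem⟩ = 0 := D.map_zero
    simpa using h⟩

lemma grading_anticomm_offDiagonal {L : Type*} [NormedAddCommGroup L] [InnerProductSpace ℂ L]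
    (S T : L →ₗ.[ℂ] L) (x : (offDiagonal S T).domain) :
    ∃ h : grading L x ∈ (offDiagonal S T).domain,
      offDiagonal S T ⟨grading L x, h⟩ = -grading L (offDiagonal S T x) := by
  obtain ⟨h1, h2⟩ := mem_offDiagonal_graph.1 ((offDiagonal S T).mem_graph x)
  refine mem_graph_iff_exists.1 (mem_offDiagonal_graph.2 ⟨?_, ?_⟩)
  · exact S.graph.neg_mem h1
  · have e : (-grading L (offDiagonal S T x)).snd = (offDiagonal S T x).snd := neg_neg _
    rw [e]
    exact h2

lemma isSelfAdjoint_grading (L : Type*) [NormedAddCommGroup L] [InnerProductSpace ℂ L]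
    [CompleteSpace L] : IsSelfAdjoint (grading L) := by
  refine ((ContinuousLinearMap.eq_adjoint_iff _ _).2 fun v w => ?_).symm
  simp only [grading, diagonal_apply, WithLp.prod_inner_apply]
  exact congrArg₂ (· + ·) rfl ((inner_neg_left _ _).trans (inner_neg_right _ _).symm)

lemma grading_mul_grading (L : Type*) [NormedAddCommGroup L] [InnerProductSpace ℂ L] :
    grading L * grading L = 1 := by
  ext1 v
  change WithLp.toLp 2 (v.fst, - -v.snd) = v
  rw [neg_neg]
  rfl

lemma grading_mul_diagonal {L : Type*} [NormedAddCommGroup L] [InnerProductSpace ℂ L]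
    (T : L →L[ℂ] L) : grading L * diagonal T T = diagonal T T * grading L := by
  ext1 v
  change WithLp.toLp 2 (T v.fst, -T v.snd) = WithLp.toLp 2 (T v.fst, T (-v.snd))
  rw [map_neg]

/-- The smooth part of the crossed product is dense, because it contains `a ⊗ Vⁿ` whenever the
commutators `[D, π(αᵏ(a))]` are uniformly bounded. -/
theorem dense_smoothPart_crossedDirac {A : Type*} [NonUnitalCStarAlgebra A] {α : A ≃⋆ₐ[ℂ] A}
    [CompleteSpace H] {π : A →⋆ₙₐ[ℂ] (H →L[ℂ] H)} {D : H →ₗ.[ℂ] H} (hD : IsSelfAdjoint D)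
    {K : Type*} [NormedAddCommGroup K] [InnerProductSpace ℂ K] [CompleteSpace K]
    {ρ : A →⋆ₙₐ[ℂ] (K →L[ℂ] K)}
    (Φ : reducedCrossedProduct ρ α →⋆ₙₐ[ℂ] (Double (L2Z H) →L[ℂ] Double (L2Z H)))
    (hΦ : ∀ a n, Φ (crossedElem ρ α a n) = diagonal (regularOp π α a n) (regularOp π α a n))
    {A' : Set A} (hA' : Dense A')
    (hbdd : ∀ a ∈ A', ∃ C : ℝ, ∀ n : ℤ, CommutatorBoundedBy D (π ((α ^ n) a)) C)
    {R : Double (L2Z H) →L[ℂ] Double (L2Z H)} (hR : IsInvOneAddSq (crossedDirac D) R)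
    (hc : IsCompactOperator R) : Dense (smoothPart Φ (crossedDirac D)) := by
  let P : Submodule ℂ (reducedCrossedProduct ρ α) :=
    { carrier := {X | ∃ C, CommutatorBoundedBy (crossedDirac D) (Φ X) C}
      zero_mem' := ⟨0, by rw [map_zero]; exact commutatorBoundedBy_zero _⟩
      add_mem' := by
        rintro X Y ⟨C, hC⟩ ⟨C', hC'⟩
        exact ⟨C + C', by rw [map_add]; exact hC.add hC'⟩
      smul_mem' := by
        rintro c X ⟨C, hC⟩
        exact ⟨‖c‖ * C, by rw [map_smul]; exact hC.smul c⟩ }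
  have hP : ∀ a ∈ A', ∀ n, crossedElem ρ α a n ∈ P := by
    intro a ha n
    obtain ⟨C, hC⟩ := hbdd a ha
    refine ⟨|C| + |(n : ℝ)| * ‖a‖, ?_⟩
    rw [hΦ]
    exact commutatorBoundedBy_crossedDirac hD hC n
  exact (dense_of_crossedElem_mem hA' P hP).mono fun X hX => ⟨hX, R, hR, hc.clm_comp (Φ X)⟩

end Main

end SpectralTriple

end

open SpectralTriple in
theorem theorem3p4 {A : Type*} [NonUnitalCStarAlgebra A] (α : A ≃⋆ₐ[ℂ] A)
    {H : Type*} [NormedAddCommGroup H] [InnerProductSpace ℂ H] [CompleteSpace H]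
    (π : A →⋆ₙₐ[ℂ] (H →L[ℂ] H)) (D : H →ₗ.[ℂ] H)
    (hD : SpectralTriple.IsSpectralTriple π D)
    (hcpt : SpectralTriple.HasCompactResolvent D)
    (A' : NonUnitalSubalgebra ℂ A)
    (hA'_smooth : (A' : Set A) ⊆ SpectralTriple.smoothPart π D)
    (hA'_dense : Dense (A' : Set A))
    (hA'_inv : ∀ a ∈ A', α a ∈ A')
    (hA'_bdd : ∀ a ∈ A', ∃ C : ℝ, ∀ n : ℤ,
      SpectralTriple.CommutatorBoundedBy D (π ((α ^ n) a)) C)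
    -- a faithful representation, on which the reduced crossed product is realized
    {K : Type*} [NormedAddCommGroup K] [InnerProductSpace ℂ K] [CompleteSpace K]
    (ρ : A →⋆ₙₐ[ℂ] (K →L[ℂ] K)) (hρ : Function.Injective ρ) :
    ∃ Φ : SpectralTriple.reducedCrossedProduct ρ α →⋆ₙₐ[ℂ]
        (SpectralTriple.Double (SpectralTriple.L2Z H) →L[ℂ]
          SpectralTriple.Double (SpectralTriple.L2Z H)),
      -- `Φ` is the diagonal action through the regular representation induced by `π`
      (∀ (a : A) (n : ℤ), Φ (SpectralTriple.crossedElem ρ α a n) =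
        SpectralTriple.diagonal (SpectralTriple.regularOp π α a n)
          (SpectralTriple.regularOp π α a n)) ∧
      SpectralTriple.IsEvenSpectralTriple Φ (SpectralTriple.crossedDirac D)
        (SpectralTriple.grading (SpectralTriple.L2Z H)) ∧
      SpectralTriple.HasCompactResolvent (SpectralTriple.crossedDirac D) ∧
      ∀ p : ℝ, 0 < p → SpectralTriple.IsWeaklySummable D p →
        SpectralTriple.IsWeaklySummable (SpectralTriple.crossedDirac D) (p + 1) := by
  have hsa := hD.selfAdjoint
  have hsa' := isSelfAdjoint_crossedDirac hsa
  have hsym' := isFormalAdjoint_self hsa'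
  -- `(1 + D²)⁻¹` exists because the smooth part, being dense, is not empty
  obtain ⟨R, hR⟩ : ∃ R, IsInvOneAddSq D R := by
    obtain ⟨a, -, R, hR, -⟩ := hD.dense_smoothPart.nonempty
    exact ⟨R, hR⟩
  have hR0 : 0 ≤ R :=
    (ContinuousLinearMap.nonneg_iff_isPositive R).2 (hR.isPositive (isFormalAdjoint_self hsa))
  have hsq : IsInvOneAddSq D (CFC.sqrt R ∘L CFC.sqrt R) := by
    have h : CFC.sqrt R ∘L CFC.sqrt R = R := CFC.sqrt_mul_sqrt_self R hR0
    rwa [h]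
  obtain ⟨-, -, 𝒯, 𝒢, -, -, -, -, h𝒢, hc⟩ := exists_crossed_inverse hsa
    ((ContinuousLinearMap.nonneg_iff_isPositive _).1 (CFC.sqrt_nonneg R)) hsq
  obtain ⟨hcR, hcG⟩ := hc hcpt
  have hinv : IsInvOneAddSq (crossedDirac D) (𝒯 ∘L 𝒯) :=
    isInvOneAddSq_of_graph hsym' fun v => ⟨𝒢 v, h𝒢 v⟩
  obtain ⟨Ψ, hΨ⟩ := exists_regular_representation (α := α) (π := π) hρ
  set Φ := (diagonalHom (L2Z H)).comp Ψ
  have hΦΨ : ∀ X, Φ X = diagonal (Ψ X) (Ψ X) := fun _ => rfl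
  have hΦelem : ∀ a n, Φ (crossedElem ρ α a n) =
      diagonal (regularOp π α a n) (regularOp π α a n) := fun a n => by rw [hΦΨ, hΨ]
  refine ⟨Φ, hΦelem, ⟨⟨?_, hsa', ?_⟩, isSelfAdjoint_grading _, grading_mul_grading _,
    fun X => grading_mul_diagonal _, grading_anticomm_offDiagonal _ _⟩,
    ⟨_, _, isResolventAt_I hsym' h𝒢, hcG.add (hcR.smul _)⟩, ?_⟩
  · have := hD.separable
    have := separableSpace_l2Z (H := H)
    exact separableSpace_double
  · exact dense_smoothPart_crossedDirac hsa Φ hΦelem hA'_dense hA'_bdd hinv hcR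
  · rintro p hp ⟨T, hT, hTinv, hTp⟩
    obtain ⟨S, hB, 𝒯', 𝒢', h𝒯', hS, hTS, hpos, h𝒢', -⟩ := exists_crossed_inverse hsa hT hTinv
    refine ⟨𝒯', hpos, isInvOneAddSq_of_graph hsym' fun v => ⟨𝒢' v, h𝒢' v⟩, ?_⟩
    rw [h𝒯']
    exact memWeakSchatten_diagonal hp hTp hS hTS hB
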